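/- Let $\mathcal H_A,\mathcal H_B$ be arbitrary complex Hilbert spaces (of any, possibly uncountable, dimension) with orthonormal bases $(e_i)_{i\in I}$, $(f_j)_{j\in J}$, and let $\varrho$ be a state on the Hilbert space tensor product $\mathcal H_A\otimes\mathcal H_B$, i.e. a positive bounded operator of trace one. Let $\mathrm{PT}$ denote partial transposition of the second factor in the product basis, $\langle e_i,f_j|C^{\rm PT}|e_k,f_l\rangle=\langle e_i,f_l|C|e_k,f_j\rangle$, and let $\mathcal P$ be the set of positive semidefinite bounded operators on $\mathcal H_A\otimes\mathcal H_B$. For $C\in\mathcal P$ write $$\operatorname{tr}(\varrho C^{\rm PT})=\lim_{(F,G)}\ \sum_{i,k\in F}\ \sum_{j,l\in G}\langle e_i,f_j|\varrho|e_k,f_l\rangle\,\langle e_k,f_l|C^{\rm PT}|e_i,f_j\rangle$$ (limit along the finite sets $F\subseteq I$, $G\subseteq J$ ordered by inclusion) whenever this limit exists; it is the usual trace if $C^{\rm PT}$ is bounded, in particular in finite dimension. A state is separable if it is a trace-norm limit of finite convex combinations of pure product states $|a,b\rangle\langle a,b|$, and entangled otherwise. It is distillable if for every $\varepsilon>0$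 there are $n$ and finitely many bounded operators $A_k:\mathcal H_A^{\otimes n}\to\mathbb C^2$, $B_k:\mathcal H_B^{\otimes n}\to\mathbb C^2$ such that $\sigma=\sum_k(A_k\otimes B_k)\varrho^{\otimes n}(A_k\otimes B_k)^\dagger$ has $\operatorname{tr}\sigma>0$ and $\langle\Phi|\sigma|\Phi\rangle\ge(1-\varepsilon)\operatorname{tr}\sigma$, where $|\Phi\rangle=(|00\rangle+|11\rangle)/\sqrt2$. It is bound entangled if it is entangled and not distillable, and PPT bound entangled if moreover $\varrho^{\rm PT}$ is positive semidefinite. Then $\varrho$ is PPT bound entangled if and only if both (1) for every $C\in\mathcal P$ the trace $\operatorname{tr}(\varrho C^{\rm PT})$ exists and $\operatorname{tr}(\varrho C^{\rm PT})\ge 0$; and (2) there is $C\in\mathcal P$ such that $\operatorname{tr}(\varrho C^{\rm PT})$ exists and $$\inf\{\langle a,b|C|a,b\rangle : a\in\mathcal H_A,\ b\in\mathcal H_B,\ \|a\|=\|b\|=1\}>\operatorname{tr}(\varrho C^{\rm PT}).$$ -/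

import Mathlib

open scoped TensorProduct InnerProductSpace Topology ComplexOrder

namespace Bipartite

noncomputable section

/-- The Hilbert space tensor product of two complex inner product spaces: the completion of the
algebraic tensor product with its inner product `⟪a ⊗ b, a' ⊗ b'⟫ = ⟪a, a'⟫ * ⟪b, b'⟫`. -/
abbrev HTensor (HA HB : Type*) [NormedAddCommGroup HA] [InnerProductSpace ℂ HA]
    [NormedAddCommGroup HB] [InnerProductSpace ℂ HB] : Type _ :=
  UniformSpace.Completion (HA ⊗[ℂ] HB)

/-- The product vector `|a, b⟩`. -/
def ket {HA HB : Type*} [NormedAddCommGroup HA] [InnerProductSpace ℂ HA]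
    [NormedAddCommGroup HB] [InnerProductSpace ℂ HB] (a : HA) (b : HB) : HTensor HA HB :=
  ((a ⊗ₜ[ℂ] b : HA ⊗[ℂ] HB) : UniformSpace.Completion (HA ⊗[ℂ] HB))

theorem inner_ket {HA HB : Type*} [NormedAddCommGroup HA] [InnerProductSpace ℂ HA]
    [NormedAddCommGroup HB] [InnerProductSpace ℂ HB] (a a' : HA) (b b' : HB) :
    ⟪ket a b, ket a' b'⟫_ℂ = ⟪a, a'⟫_ℂ * ⟪b, b'⟫_ℂ := by
  simp [ket, UniformSpace.Completion.inner_coe]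

theorem continuous_ket {HA HB : Type*} [NormedAddCommGroup HA] [InnerProductSpace ℂ HA]
    [NormedAddCommGroup HB] [InnerProductSpace ℂ HB] :
    Continuous fun p : HA × HB => (ket p.1 p.2 : HTensor HA HB) :=
  (UniformSpace.Completion.continuous_coe _).comp TensorProduct.continuous_tmul

theorem orthonormal_ket {HA HB I J : Type*} [NormedAddCommGroup HA] [InnerProductSpace ℂ HA]
    [NormedAddCommGroup HB] [InnerProductSpace ℂ HB] {e : I → HA} {f : J → HB}
    (he : Orthonormal ℂ e) (hf : Orthonormal ℂ f) :
    Orthonormal ℂ fun p : I × J => (ket (e p.1) (f p.2) : HTensor HA HB) := by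
  classical
  rw [orthonormal_iff_ite] at he hf ⊢
  rintro ⟨i, j⟩ ⟨k, l⟩
  rw [inner_ket, he, hf]
  by_cases h1 : i = k <;> by_cases h2 : j = l <;> simp [h1, h2]

theorem span_ket_dense {HA HB I J : Type*} [NormedAddCommGroup HA] [InnerProductSpace ℂ HA]
    [NormedAddCommGroup HB] [InnerProductSpace ℂ HB]
    (e : HilbertBasis I ℂ HA) (f : HilbertBasis J ℂ HB) :
    ⊤ ≤ (Submodule.span ℂ (Set.range
      fun p : I × J => (ket (e p.1) (f p.2) : HTensor HA HB))).topologicalClosure := by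
  set S := (Submodule.span ℂ (Set.range
      fun p : I × J => (ket (e p.1) (f p.2) : HTensor HA HB))).topologicalClosure with hS
  have hcl : IsClosed (S : Set (HTensor HA HB)) := Submodule.isClosed_topologicalClosure _
  have hadd1 : ∀ (a a' : HA) (b : HB), (ket (a + a') b : HTensor HA HB) = ket a b + ket a' b :=
    fun a a' b => by simp [ket, TensorProduct.add_tmul, UniformSpace.Completion.coe_add]
  have hsm1 : ∀ (c : ℂ) (a : HA) (b : HB), (ket (c • a) b : HTensor HA HB) = c • ket a b :=
    fun c a b => by
      unfold ket
      rw [← TensorProduct.smul_tmul', UniformSpace.Completion.coe_smul]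
  have hadd2 : ∀ (a : HA) (b b' : HB), (ket a (b + b') : HTensor HA HB) = ket a b + ket a b' :=
    fun a b b' => by simp [ket, TensorProduct.tmul_add, UniformSpace.Completion.coe_add]
  have hsm2 : ∀ (c : ℂ) (a : HA) (b : HB), (ket a (c • b) : HTensor HA HB) = c • ket a b :=
    fun c a b => by simp [ket, TensorProduct.tmul_smul, UniformSpace.Completion.coe_smul]
  have h0 : ∀ i j, (ket (e i) (f j) : HTensor HA HB) ∈ S := fun i j =>
    Submodule.le_topologicalClosure _ (Submodule.subset_span ⟨(i, j), rfl⟩)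
  have h1 : ∀ (a : HA) (j : J), (ket a (f j) : HTensor HA HB) ∈ S := by
    intro a j
    let L : HA →ₗ[ℂ] HTensor HA HB :=
      { toFun := fun a => ket a (f j), map_add' := fun _ _ => hadd1 _ _ _,
        map_smul' := fun _ _ => hsm1 _ _ _ }
    have hLc : Continuous L := continuous_ket.comp (Continuous.prodMk_left (f j))
    have hle : (Submodule.span ℂ (Set.range e)).topologicalClosure ≤ S.comap L := by
      refine Submodule.topologicalClosure_minimal _ (Submodule.span_le.2 ?_) (hcl.preimage hLc)
      rintro _ ⟨i, rfl⟩
      exact h0 i j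
    rw [e.dense_span] at hle
    exact hle (Submodule.mem_top (x := a))
  have h2 : ∀ (a : HA) (b : HB), (ket a b : HTensor HA HB) ∈ S := by
    intro a b
    let L : HB →ₗ[ℂ] HTensor HA HB :=
      { toFun := fun b => ket a b, map_add' := fun _ _ => hadd2 _ _ _,
        map_smul' := fun _ _ => hsm2 _ _ _ }
    have hLc : Continuous L := continuous_ket.comp (Continuous.prodMk_right a)
    have hle : (Submodule.span ℂ (Set.range f)).topologicalClosure ≤ S.comap L := by
      refine Submodule.topologicalClosure_minimal _ (Submodule.span_le.2 ?_) (hcl.preimage hLc)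
      rintro _ ⟨j, rfl⟩
      exact h1 a j
    rw [f.dense_span] at hle
    exact hle (Submodule.mem_top (x := b))
  rintro x -
  induction x using UniformSpace.Completion.induction_on with
  | hp => exact hcl
  | ih x =>
    induction x using TensorProduct.induction_on with
    | zero => rw [UniformSpace.Completion.coe_zero]; exact S.zero_mem
    | tmul a b => exact h2 a b
    | add x y hx hy => rw [UniformSpace.Completion.coe_add]; exact S.add_mem hx hy

/-- The product basis `|e_i, f_j⟩` of the Hilbert space tensor product. -/
def prodBasis {HA HB I J : Type*} [NormedAddCommGroup HA] [InnerProductSpace ℂ HA]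
    [NormedAddCommGroup HB] [InnerProductSpace ℂ HB]
    (e : HilbertBasis I ℂ HA) (f : HilbertBasis J ℂ HB) :
    HilbertBasis (I × J) ℂ (HTensor HA HB) :=
  HilbertBasis.mk (orthonormal_ket e.orthonormal f.orthonormal) (span_ket_dense e f)

theorem prodBasis_apply {HA HB I J : Type*} [NormedAddCommGroup HA] [InnerProductSpace ℂ HA]
    [NormedAddCommGroup HB] [InnerProductSpace ℂ HB]
    (e : HilbertBasis I ℂ HA) (f : HilbertBasis J ℂ HB) (p : I × J) :
    prodBasis e f p = ket (e p.1) (f p.2) := by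
  simp [prodBasis]

/-- The (possibly infinite) matrix `⟨b x| T |b y⟩` of a bounded operator. -/
def opMatrix {H ι : Type*} [NormedAddCommGroup H] [InnerProductSpace ℂ H]
    (b : HilbertBasis ι ℂ H) (T : H →L[ℂ] H) : Matrix ι ι ℂ :=
  Matrix.of fun x y => ⟪b x, T (b y)⟫_ℂ

/-- A state (density operator): a positive bounded operator of trace one. The trace of a positive
operator does not depend on the orthonormal basis `b` in which it is computed. -/
def IsState {H ι : Type*} [NormedAddCommGroup H] [InnerProductSpace ℂ H]
    (b : HilbertBasis ι ℂ H) (ρ : H →L[ℂ] H) : Prop :=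
  ρ.IsPositive ∧ HasSum (fun x => opMatrix b ρ x x) 1

/-- The trace norm of `T` is at most `r`. For every bounded operator,
`‖T‖₁ = sup ∑ |⟨u_k| T |v_k⟩|` over all pairs of finite orthonormal families. -/
def TraceNormLE {H : Type*} [NormedAddCommGroup H] [InnerProductSpace ℂ H]
    (T : H →L[ℂ] H) (r : ℝ) : Prop :=
  ∀ (n : ℕ) (u v : Fin n → H), Orthonormal ℂ u → Orthonormal ℂ v →
    ∑ k, ‖⟪u k, T (v k)⟫_ℂ‖ ≤ r

/-- Pure product states `|a, b⟩⟨a, b|` with unit vectors `a`, `b`. -/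
def pureProductStates (HA HB : Type*) [NormedAddCommGroup HA] [InnerProductSpace ℂ HA]
    [NormedAddCommGroup HB] [InnerProductSpace ℂ HB] :
    Set (HTensor HA HB →L[ℂ] HTensor HA HB) :=
  {σ | ∃ (a : HA) (b : HB), ‖a‖ = 1 ∧ ‖b‖ = 1 ∧
    σ = InnerProductSpace.rankOne ℂ (ket a b) (ket a b)}

/-- A state is separable if it is a trace-norm limit of finite mixtures of product states
(in finite dimension the limit is not needed). -/
def IsSeparable {HA HB : Type*} [NormedAddCommGroup HA] [InnerProductSpace ℂ HA]
    [NormedAddCommGroup HB] [InnerProductSpace ℂ HB]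
    (ρ : HTensor HA HB →L[ℂ] HTensor HA HB) : Prop :=
  ∀ ε : ℝ, 0 < ε → ∃ σ ∈ convexHull ℝ (pureProductStates HA HB), TraceNormLE (ρ - σ) ε

/-- A state is entangled if it is not separable. -/
def IsEntangled {HA HB : Type*} [NormedAddCommGroup HA] [InnerProductSpace ℂ HA]
    [NormedAddCommGroup HB] [InnerProductSpace ℂ HB]
    (ρ : HTensor HA HB →L[ℂ] HTensor HA HB) : Prop :=
  ¬ IsSeparable ρ

/-- Partial transposition (on the second factor) of a matrix in a product basis:
`⟨i, j| M^PT |k, l⟩ = ⟨i, l| M |k, j⟩`. -/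
def partialTranspose {I J : Type*} (M : Matrix (I × J) (I × J) ℂ) : Matrix (I × J) (I × J) ℂ :=
  Matrix.of fun x y => M (x.1, y.2) (y.1, x.2)

/-- `ρ` has a positive partial transposition (with respect to the bases `e`, `f`). -/
def IsPPT {HA HB I J : Type*} [NormedAddCommGroup HA] [InnerProductSpace ℂ HA]
    [NormedAddCommGroup HB] [InnerProductSpace ℂ HB]
    (e : HilbertBasis I ℂ HA) (f : HilbertBasis J ℂ HB)
    (ρ : HTensor HA HB →L[ℂ] HTensor HA HB) : Prop :=
  (partialTranspose (opMatrix (prodBasis e f) ρ)).PosSemidef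

/-- `tr (ρ C^PT)` converges and equals `t`: the limit, over finite sets `F`, `G` of basis vectors,
of the traces of the compressions to the span of `|e_i, f_j⟩`, `i ∈ F`, `j ∈ G`. The limit is used
since `C^PT` need not be bounded in infinite dimension; where `C^PT` is bounded and `ρ` is a state,
it is the usual trace, and in finite dimension it is the usual finite sum. -/
def HasTracePT {HA HB I J : Type*} [NormedAddCommGroup HA] [InnerProductSpace ℂ HA]
    [NormedAddCommGroup HB] [InnerProductSpace ℂ HB]
    (e : HilbertBasis I ℂ HA) (f : HilbertBasis J ℂ HB)
    (ρ C : HTensor HA HB →L[ℂ] HTensor HA HB) (t : ℝ) : Prop :=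
  Filter.Tendsto
    (fun S : Finset I × Finset J => ∑ x ∈ S.1 ×ˢ S.2, ∑ y ∈ S.1 ×ˢ S.2,
      opMatrix (prodBasis e f) ρ x y * partialTranspose (opMatrix (prodBasis e f) C) y x)
    Filter.atTop (𝓝 (t : ℂ))

/-- `inf ⟨a, b| C |a, b⟩` over unit vectors `a`, `b`. -/
def infProduct {HA HB : Type*} [NormedAddCommGroup HA] [InnerProductSpace ℂ HA]
    [NormedAddCommGroup HB] [InnerProductSpace ℂ HB]
    (C : HTensor HA HB →L[ℂ] HTensor HA HB) : ℝ :=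
  sInf {r : ℝ | ∃ (a : HA) (b : HB), ‖a‖ = 1 ∧ ‖b‖ = 1 ∧ r = (⟪ket a b, C (ket a b)⟫_ℂ).re}

/-- The Hilbert space `ℓ²(κ)`. -/
abbrev L2 (κ : Type*) : Type _ := lp (fun _ : κ => ℂ) 2

/-- The standard basis of `ℓ²(κ)`. -/
def stdBasis (κ : Type*) : HilbertBasis κ ℂ (L2 κ) :=
  HilbertBasis.ofRepr (LinearIsometryEquiv.refl ℂ (L2 κ))

/-- `R` is the state `ρ^{⊗n}` of `n` copies of `ρ`, as a bipartite operator. The spaces of the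
`n` systems of each side, `H_A^{⊗n}` and `H_B^{⊗n}`, are written in their product bases
`e_{i_1} ⊗ ⋯ ⊗ e_{i_n}` and `f_{j_1} ⊗ ⋯ ⊗ f_{j_n}`, that is as `ℓ²(I^n)` and `ℓ²(J^n)`. -/
def IsCopies {HA HB I J : Type*} [NormedAddCommGroup HA] [InnerProductSpace ℂ HA]
    [NormedAddCommGroup HB] [InnerProductSpace ℂ HB]
    (e : HilbertBasis I ℂ HA) (f : HilbertBasis J ℂ HB)
    (ρ : HTensor HA HB →L[ℂ] HTensor HA HB) (n : ℕ)
    (R : HTensor (L2 (Fin n → I)) (L2 (Fin n → J)) →L[ℂ]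
      HTensor (L2 (Fin n → I)) (L2 (Fin n → J))) : Prop :=
  ∀ (i i' : Fin n → I) (j j' : Fin n → J),
    opMatrix (prodBasis (stdBasis (Fin n → I)) (stdBasis (Fin n → J))) R (i, j) (i', j') =
      ∏ k, opMatrix (prodBasis e f) ρ (i k, j k) (i' k, j' k)

/-- One qubit. -/
abbrev Qubit : Type := EuclideanSpace ℂ (Fin 2)

/-- The unnormalized two-qubit output `∑_k (A_k ⊗ B_k) R (A_k ⊗ B_k)†` of local operations on `R`,
as a density matrix in the computational basis. -/
def localOutput {KA KB : Type*} [NormedAddCommGroup KA] [InnerProductSpace ℂ KA] [CompleteSpace KA]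
    [NormedAddCommGroup KB] [InnerProductSpace ℂ KB] [CompleteSpace KB] {m : ℕ}
    (A : Fin m → KA →L[ℂ] Qubit) (B : Fin m → KB →L[ℂ] Qubit)
    (R : HTensor KA KB →L[ℂ] HTensor KA KB) : Matrix (Fin 2 × Fin 2) (Fin 2 × Fin 2) ℂ :=
  Matrix.of fun x y => ∑ k,
    ⟪ket ((A k).adjoint (EuclideanSpace.single x.1 1)) ((B k).adjoint (EuclideanSpace.single x.2 1)),
      R (ket ((A k).adjoint (EuclideanSpace.single y.1 1))
        ((B k).adjoint (EuclideanSpace.single y.2 1)))⟫_ℂ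

/-- The expectation value `⟨Φ| σ |Φ⟩` in the maximally entangled two-qubit state
`|Φ⟩ = (|00⟩ + |11⟩) / √2`. -/
def singletOverlap (σ : Matrix (Fin 2 × Fin 2) (Fin 2 × Fin 2) ℂ) : ℝ :=
  ((∑ s : Fin 2, ∑ t : Fin 2, σ (s, s) (t, t)) / 2).re

/-- `ρ` is distillable: from finitely many copies of `ρ` one can obtain, by local operations and
classical communication and with nonzero probability, two-qubit states of fidelity arbitrarily
close to one with a maximally entangled state. Every such protocol with postselection acts as
`R ↦ ∑_k (A_k ⊗ B_k) R (A_k ⊗ B_k)†`, up to normalization, the sum being over its accepted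
branches; conversely the best single branch `A_k ⊗ B_k`, rescaled to contractions, is a protocol of
local filtering whose output fidelity is at least that of the sum. -/
def IsDistillable {HA HB I J : Type*} [NormedAddCommGroup HA] [InnerProductSpace ℂ HA]
    [NormedAddCommGroup HB] [InnerProductSpace ℂ HB]
    (e : HilbertBasis I ℂ HA) (f : HilbertBasis J ℂ HB)
    (ρ : HTensor HA HB →L[ℂ] HTensor HA HB) : Prop :=
  ∀ ε : ℝ, 0 < ε → ∃ (n : ℕ) (R : HTensor (L2 (Fin n → I)) (L2 (Fin n → J)) →L[ℂ]
      HTensor (L2 (Fin n → I)) (L2 (Fin n → J))), IsCopies e f ρ n R ∧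
    ∃ (m : ℕ) (A : Fin m → L2 (Fin n → I) →L[ℂ] Qubit) (B : Fin m → L2 (Fin n → J) →L[ℂ] Qubit),
      0 < (localOutput A B R).trace.re ∧
        (1 - ε) * (localOutput A B R).trace.re ≤ singletOverlap (localOutput A B R)

/-- A bound entangled state: entangled, but its entanglement cannot be distilled. -/
def IsBoundEntangled {HA HB I J : Type*} [NormedAddCommGroup HA] [InnerProductSpace ℂ HA]
    [NormedAddCommGroup HB] [InnerProductSpace ℂ HB]
    (e : HilbertBasis I ℂ HA) (f : HilbertBasis J ℂ HB)
    (ρ : HTensor HA HB →L[ℂ] HTensor HA HB) : Prop :=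
  IsEntangled ρ ∧ ¬ IsDistillable e f ρ

end

end Bipartite

namespace Bipartite

noncomputable section

/-! ### Finite sections of infinite matrices -/

/-! Partial transposition permutes pairs of indices inside a finite rectangle `F ×ˢ G`, so on each
rectangle the truncated `tr (ρ C^PT)` equals the truncated `tr (ρ^PT C)` exactly
(`sum_mul_partialTranspose`). The theorem then splits into two independent equivalences and one
implication.

Condition (1) amounts to PPT. A positive matrix `ρ^PT` has the summable diagonal of `ρ`, so its
truncated traces against a bounded `C` form a Cauchy net, with nonnegative limit if `C` is positive.
Conversely `C = |ψ⟩⟨ψ|`, with `ψ` a finite combination of basis vectors, tests `ρ^PT` on `ψ`.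

PPT excludes distillability. It passes to `n` copies by the Schur product theorem, and testing
`R^PT` on differences of two product vectors bounds the overlap of every local two-qubit output with
`Φ` by half its trace (`IsPPT.singletOverlap_le`).

Condition (2) amounts to entanglement. The partial transpose of `|a, b⟩⟨a, b|` is `|a, b̄⟩⟨a, b̄|`,
so on product states `tr (σ C^PT)` is at least the product infimum of `C`, and this bound survives
mixtures and limits (`IsSeparable.infProduct_le`). If `ρ` is entangled, some finite section of it
lies outside the closed cone of separable sections, since `ρ` is the trace-norm limit of its
sections. Hahn–Banach gives a finitely supported Hermitian `K`, nonnegative on product vectors, with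
`tr (ρ K) < 0`. Let `D` be the operator of `K^PT`. Then `C = ‖D‖ + D` is positive, its product
expectations are at least `‖D‖`, and `tr (ρ C^PT) = ‖D‖ + tr (ρ K) < ‖D‖`. -/

/-- The sesquilinear form of the section of a matrix on a finite set of indices. -/
def sectionForm {ι : Type*} (M : Matrix ι ι ℂ) (S : Finset ι) (φ ψ : ι → ℂ) : ℂ :=
  ∑ x ∈ S, ∑ y ∈ S, star (φ x) * M x y * ψ y

/-- The product of two coefficient families. -/
def tprod {I J : Type*} (a : I → ℂ) (b : J → ℂ) : I × J → ℂ := fun x => a x.1 * b x.2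

/-- The finite linear combination `∑ x ∈ S, φ x • b x`. -/
def combo {H ι : Type*} [NormedAddCommGroup H] [InnerProductSpace ℂ H]
    (b : ι → H) (S : Finset ι) (φ : ι → ℂ) : H := ∑ x ∈ S, φ x • b x

/-- Exchanging the second components of two indices is an involution on pairs from a rectangle. It
need not preserve pairs from an arbitrary finite set, whence the limits over rectangles. -/
theorem sum_rectangle_swap {I J : Type*} (F : Finset I) (G : Finset J)
    (g : I × J → I × J → ℂ) :
    ∑ x ∈ F ×ˢ G, ∑ y ∈ F ×ˢ G, g x y =
      ∑ x ∈ F ×ˢ G, ∑ y ∈ F ×ˢ G, g (x.1, y.2) (y.1, x.2) := by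
  rw [← Finset.sum_product', ← Finset.sum_product']
  refine Finset.sum_nbij' (fun p => ((p.1.1, p.2.2), (p.2.1, p.1.2)))
    (fun p => ((p.1.1, p.2.2), (p.2.1, p.1.2))) ?_ ?_ ?_ ?_ ?_ <;>
  simp +contextual

theorem partialTranspose_partialTranspose {I J : Type*} (M : Matrix (I × J) (I × J) ℂ) :
    partialTranspose (partialTranspose M) = M := rfl

theorem sum_mul_partialTranspose {I J : Type*} (F : Finset I) (G : Finset J)
    (M N : Matrix (I × J) (I × J) ℂ) :
    ∑ x ∈ F ×ˢ G, ∑ y ∈ F ×ˢ G, M x y * partialTranspose N y x =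
      ∑ x ∈ F ×ˢ G, ∑ y ∈ F ×ˢ G, partialTranspose M x y * N y x := by
  rw [sum_rectangle_swap]
  rfl

/-- Moving the transposition from the matrix to the vectors exchanges and conjugates their second
factors. On a diagonal expectation only the conjugation remains. -/
theorem sectionForm_partialTranspose {I J : Type*} (F : Finset I) (G : Finset J)
    (M : Matrix (I × J) (I × J) ℂ) (a c : I → ℂ) (b d : J → ℂ) :
    sectionForm M (F ×ˢ G) (tprod a b) (tprod c d) =
      sectionForm (partialTranspose M) (F ×ˢ G) (tprod a (star d)) (tprod c (star b)) := by
  unfold sectionForm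
  rw [sum_rectangle_swap]
  refine Finset.sum_congr rfl fun x _ => Finset.sum_congr rfl fun y _ => ?_
  simp only [tprod, partialTranspose, Matrix.of_apply, star_mul', Pi.star_apply, star_star]
  ring

theorem sectionForm_nonneg {ι : Type*} {M : Matrix ι ι ℂ} (hM : M.PosSemidef) (S : Finset ι)
    (φ : ι → ℂ) : 0 ≤ sectionForm M S φ φ := by
  classical
  have h := hM.2 (Finsupp.onFinset S (fun x => if x ∈ S then φ x else 0) (by simp +contextual))
  rw [Finsupp.onFinset_sum _ (by simp)] at h
  convert h using 1
  refine Finset.sum_congr rfl fun x hx => ?_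
  rw [Finsupp.onFinset_sum _ (by simp)]
  refine Finset.sum_congr rfl fun y hy => ?_
  simp [hx, hy]

theorem inner_combo_apply_combo {H ι : Type*} [NormedAddCommGroup H] [InnerProductSpace ℂ H]
    (b : HilbertBasis ι ℂ H) (T : H →L[ℂ] H) (S : Finset ι) (φ ψ : ι → ℂ) :
    ⟪combo b S φ, T (combo b S ψ)⟫_ℂ = sectionForm (opMatrix b T) S φ ψ := by
  rw [combo, sum_inner]
  refine Finset.sum_congr rfl fun x _ => ?_
  rw [combo, map_sum, inner_sum]
  refine Finset.sum_congr rfl fun y _ => ?_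
  rw [map_smul, inner_smul_left, inner_smul_right, opMatrix, Matrix.of_apply, starRingEnd_apply]
  ring

/-- `ket` as a bilinear map. -/
def ketₗ (HA HB : Type*) [NormedAddCommGroup HA] [InnerProductSpace ℂ HA]
    [NormedAddCommGroup HB] [InnerProductSpace ℂ HB] : HA →ₗ[ℂ] HB →ₗ[ℂ] HTensor HA HB :=
  (TensorProduct.mk ℂ HA HB).compr₂ UniformSpace.Completion.toComplₗᵢ.toLinearMap

theorem ketₗ_apply {HA HB : Type*} [NormedAddCommGroup HA] [InnerProductSpace ℂ HA]
    [NormedAddCommGroup HB] [InnerProductSpace ℂ HB] (a : HA) (b : HB) :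
    ketₗ HA HB a b = ket a b := rfl

theorem norm_ket {HA HB : Type*} [NormedAddCommGroup HA] [InnerProductSpace ℂ HA]
    [NormedAddCommGroup HB] [InnerProductSpace ℂ HB] (a : HA) (b : HB) :
    ‖(ket a b : HTensor HA HB)‖ = ‖a‖ * ‖b‖ := by
  have h : ‖(ket a b : HTensor HA HB)‖ ^ 2 = (‖a‖ * ‖b‖) ^ 2 := by
    have h1 := inner_ket a a b b
    rw [inner_self_eq_norm_sq_to_K, inner_self_eq_norm_sq_to_K, inner_self_eq_norm_sq_to_K] at h1
    rw [mul_pow]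
    exact_mod_cast h1
  exact (pow_left_inj₀ (norm_nonneg _) (by positivity) two_ne_zero).1 h

theorem ket_combo {HA HB I J : Type*} [NormedAddCommGroup HA] [InnerProductSpace ℂ HA]
    [NormedAddCommGroup HB] [InnerProductSpace ℂ HB]
    (e : HilbertBasis I ℂ HA) (f : HilbertBasis J ℂ HB) (F : Finset I) (G : Finset J)
    (a : I → ℂ) (b : J → ℂ) :
    ket (combo e F a) (combo f G b) = combo (prodBasis e f) (F ×ˢ G) (tprod a b) := by
  rw [← ketₗ_apply, combo, combo, combo, Finset.sum_product]
  rw [map_sum (ketₗ HA HB), LinearMap.sum_apply]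
  refine Finset.sum_congr rfl fun i _ => ?_
  rw [map_sum]
  refine Finset.sum_congr rfl fun j _ => ?_
  rw [map_smul, map_smul, LinearMap.smul_apply, prodBasis_apply, ketₗ_apply, tprod, mul_comm,
    mul_smul]

theorem tendsto_combo {H ι : Type*} [NormedAddCommGroup H] [InnerProductSpace ℂ H]
    (b : HilbertBasis ι ℂ H) (v : H) :
    Filter.Tendsto (fun S : Finset ι => combo b S (fun x => ⟪b x, v⟫_ℂ)) Filter.atTop (𝓝 v) := by
  simpa [HilbertBasis.repr_apply_apply] using! b.hasSum_repr v

/-- Truncations of a product matrix element converge to it. -/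
theorem tendsto_sectionForm_tprod {HA HB I J : Type*} [NormedAddCommGroup HA]
    [InnerProductSpace ℂ HA] [NormedAddCommGroup HB] [InnerProductSpace ℂ HB]
    (e : HilbertBasis I ℂ HA) (f : HilbertBasis J ℂ HB)
    (R : HTensor HA HB →L[ℂ] HTensor HA HB) (a c : HA) (b d : HB) :
    Filter.Tendsto (fun S : Finset I × Finset J =>
      sectionForm (opMatrix (prodBasis e f) R) (S.1 ×ˢ S.2)
        (tprod (fun i => ⟪e i, a⟫_ℂ) (fun j => ⟪f j, b⟫_ℂ))
        (tprod (fun i => ⟪e i, c⟫_ℂ) (fun j => ⟪f j, d⟫_ℂ)))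
      Filter.atTop (𝓝 ⟪ket a b, R (ket c d)⟫_ℂ) := by
  rw [← Filter.prod_atTop_atTop_eq]
  have hA := fun v : HA => (tendsto_combo e v).comp
    (Filter.tendsto_fst (f := (Filter.atTop : Filter (Finset I)))
      (g := (Filter.atTop : Filter (Finset J))))
  have hB := fun v : HB => (tendsto_combo f v).comp
    (Filter.tendsto_snd (f := (Filter.atTop : Filter (Finset I)))
      (g := (Filter.atTop : Filter (Finset J))))
  have hk := fun (v : HA) (w : HB) =>
    (continuous_ket.tendsto (v, w)).comp ((hA v).prodMk_nhds (hB w))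
  have := (hk a b).inner (𝕜 := ℂ) ((R.continuous.tendsto _).comp (hk c d))
  refine this.congr fun S => ?_
  simp only [Function.comp_apply]
  rw [ket_combo, ket_combo, inner_combo_apply_combo]

/-- Any finite set lies in the rectangle of its two projections, so unconditional sums may be
computed along rectangles. -/
theorem tendsto_rectangle {I J : Type*} :
    Filter.Tendsto (fun S : Finset I × Finset J => S.1 ×ˢ S.2) Filter.atTop Filter.atTop := by
  classical
  refine Filter.tendsto_atTop_atTop.2 fun U => ⟨(U.image Prod.fst, U.image Prod.snd),
    fun S hS x hx => ?_⟩
  exact Finset.mem_product.2 ⟨hS.1 (Finset.mem_image_of_mem _ hx),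
    hS.2 (Finset.mem_image_of_mem _ hx)⟩

/-! ### Partial transposes of states that are positive -/

-- The finite submatrix is `B⋆ B`; the vectors `v k` are the conjugated rows of `B`, extended by
-- zero.
open scoped MatrixOrder in
theorem exists_gram_section {ι : Type*} {M : Matrix ι ι ℂ} (hM : M.PosSemidef) (T : Finset ι) :
    ∃ v : T → ι → ℂ, ∀ x ∈ T, ∀ y ∈ T, M x y = ∑ k, v k x * star (v k y) := by
  classical
  have h : (0 : Matrix T T ℂ) ≤ M.submatrix (fun x : T => (x : ι)) (fun x : T => (x : ι)) :=
    Matrix.nonneg_iff_posSemidef.2 (hM.submatrix _)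
  obtain ⟨B, hB⟩ := CStarAlgebra.nonneg_iff_eq_star_mul_self.1 h
  refine ⟨fun k x => if hx : x ∈ T then star (B k ⟨x, hx⟩) else 0, fun x hx y hy => ?_⟩
  have := congrFun (congrFun hB ⟨x, hx⟩) ⟨y, hy⟩
  simp only [Matrix.submatrix_apply, Matrix.mul_apply, Matrix.star_apply] at this
  simp only [hx, hy, dif_pos, star_star]
  exact this

/-- The trace of the product of two sections, as a sum of expectation values. -/
theorem sum_mul_eq_sum_inner {H ι κ : Type*} [NormedAddCommGroup H] [InnerProductSpace ℂ H]
    [Fintype κ] (b : HilbertBasis ι ℂ H) (C : H →L[ℂ] H) (M : Matrix ι ι ℂ) (S : Finset ι)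
    (v : κ → ι → ℂ) (hv : ∀ x ∈ S, ∀ y ∈ S, M x y = ∑ k, v k x * star (v k y)) :
    ∑ x ∈ S, ∑ y ∈ S, M x y * opMatrix b C y x =
      ∑ k, ⟪combo b S (v k), C (combo b S (v k))⟫_ℂ := by
  simp only [inner_combo_apply_combo, sectionForm]
  rw [Finset.sum_comm (s := Finset.univ), Finset.sum_comm]
  refine Finset.sum_congr rfl fun y hy => ?_
  rw [Finset.sum_comm (s := Finset.univ)]
  refine Finset.sum_congr rfl fun x hx => ?_
  rw [hv x hx y hy, Finset.sum_mul]
  exact Finset.sum_congr rfl fun k _ => by ring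

theorem norm_combo_sq {H ι : Type*} [NormedAddCommGroup H] [InnerProductSpace ℂ H]
    {b : ι → H} (hb : Orthonormal ℂ b) (S : Finset ι) (φ : ι → ℂ) :
    ‖combo b S φ‖ ^ 2 = ∑ x ∈ S, ‖φ x‖ ^ 2 := by
  have h := hb.inner_sum φ φ S
  rw [inner_self_eq_norm_sq_to_K] at h
  have h2 : ((‖combo b S φ‖ ^ 2 : ℝ) : ℂ) = ((∑ x ∈ S, ‖φ x‖ ^ 2 : ℝ) : ℂ) := by
    push_cast
    refine Eq.trans h (Finset.sum_congr rfl fun x _ => ?_)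
    rw [RCLike.conj_mul]
    rfl
  exact_mod_cast h2

theorem sum_norm_combo_sq {H ι κ : Type*} [NormedAddCommGroup H] [InnerProductSpace ℂ H]
    [Fintype κ] {b : ι → H} (hb : Orthonormal ℂ b) (M : Matrix ι ι ℂ) (S : Finset ι)
    (v : κ → ι → ℂ) (hv : ∀ x ∈ S, M x x = ∑ k, v k x * star (v k x)) :
    ∑ k, ‖combo b S (v k)‖ ^ 2 = ∑ x ∈ S, (M x x).re := by
  simp only [norm_combo_sq hb]
  rw [Finset.sum_comm]
  refine Finset.sum_congr rfl fun x hx => ?_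
  rw [hv x hx, Complex.re_sum]
  refine Finset.sum_congr rfl fun k _ => ?_
  rw [Complex.star_def, Complex.mul_conj, Complex.ofReal_re, Complex.normSq_eq_norm_sq]

theorem sum_mul_le_sqrt_mul_sqrt_of_le {κ : Type*} [Fintype κ] {f g : κ → ℝ} {p q : ℝ}
    (hf : ∑ k, f k ^ 2 ≤ p) (hg : ∑ k, g k ^ 2 ≤ q) : ∑ k, f k * g k ≤ √p * √q :=
  (Real.sum_mul_le_sqrt_mul_sqrt _ f g).trans
    (mul_le_mul (Real.sqrt_le_sqrt hf) (Real.sqrt_le_sqrt hg) (Real.sqrt_nonneg _)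
      (Real.sqrt_nonneg _))

/-- Enlarging the section changes the trace of `M C` by little if little of the trace of `M` is
outside the section. -/
theorem norm_section_trace_sub_le {H ι : Type*} [NormedAddCommGroup H] [InnerProductSpace ℂ H]
    [DecidableEq ι] (b : HilbertBasis ι ℂ H) (C : H →L[ℂ] H) {M : Matrix ι ι ℂ}
    (hM : M.PosSemidef) {S T : Finset ι} (hST : S ⊆ T) :
    ‖∑ x ∈ T, ∑ y ∈ T, M x y * opMatrix b C y x - ∑ x ∈ S, ∑ y ∈ S, M x y * opMatrix b C y x‖ ≤
      2 * ‖C‖ * (√(∑ x ∈ T \ S, (M x x).re) * √(∑ x ∈ T, (M x x).re)) := by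
  obtain ⟨v, hv⟩ := exists_gram_section hM T
  rw [sum_mul_eq_sum_inner b C M T v hv,
    sum_mul_eq_sum_inner b C M S v fun x hx y hy => hv x (hST hx) y (hST hy),
    ← Finset.sum_sub_distrib]
  -- The Gram vectors of `T` also serve `S`: `P` is their part on `S` and `Q` the remainder. Only
  -- terms containing `Q` survive in the difference, and Cauchy–Schwarz over `k` turns the norms
  -- back into partial traces of `M`.
  set P : T → H := fun k => combo b S (v k) with hP
  set Q : T → H := fun k => combo b (T \ S) (v k) with hQ
  have hPQ : ∀ k, combo b T (v k) = Q k + P k := fun k => (Finset.sum_sdiff hST).symm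
  have hTn := (sum_norm_combo_sq b.orthonormal M T v fun x hx => hv x hx x hx).le
  have hQn := (sum_norm_combo_sq b.orthonormal M (T \ S) v fun x hx =>
    hv x (Finset.sdiff_subset hx) x (Finset.sdiff_subset hx)).le
  have hPle : ∀ k, ‖P k‖ ≤ ‖combo b T (v k)‖ := fun k => by
    refine le_of_sq_le_sq ?_ (norm_nonneg _)
    rw [norm_combo_sq b.orthonormal, norm_combo_sq b.orthonormal]
    exact Finset.sum_le_sum_of_subset_of_nonneg hST fun _ _ _ => by positivity
  have hterm : ∀ k, ‖⟪combo b T (v k), C (combo b T (v k))⟫_ℂ - ⟪P k, C (P k)⟫_ℂ‖ ≤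
      2 * ‖C‖ * (‖Q k‖ * ‖combo b T (v k)‖) := fun k => by
    have h1 : ⟪combo b T (v k), C (combo b T (v k))⟫_ℂ - ⟪P k, C (P k)⟫_ℂ =
        ⟪Q k, C (combo b T (v k))⟫_ℂ + ⟪P k, C (Q k)⟫_ℂ := by
      rw [hPQ k]
      simp only [map_add, inner_add_left, inner_add_right]
      ring
    rw [h1]
    refine (norm_add_le _ _).trans ?_
    have h2 : ‖⟪Q k, C (combo b T (v k))⟫_ℂ‖ ≤ ‖Q k‖ * (‖C‖ * ‖combo b T (v k)‖) :=
      (norm_inner_le_norm _ _).trans (mul_le_mul_of_nonneg_left (C.le_opNorm _) (norm_nonneg _))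
    have h3 : ‖⟪P k, C (Q k)⟫_ℂ‖ ≤ ‖combo b T (v k)‖ * (‖C‖ * ‖Q k‖) :=
      (norm_inner_le_norm _ _).trans
        (mul_le_mul (hPle k) (C.le_opNorm _) (norm_nonneg _) (norm_nonneg _))
    linarith
  calc _ ≤ ∑ k, 2 * ‖C‖ * (‖Q k‖ * ‖combo b T (v k)‖) :=
        (norm_sum_le _ _).trans (Finset.sum_le_sum fun k _ => hterm k)
    _ = 2 * ‖C‖ * ∑ k, ‖Q k‖ * ‖combo b T (v k)‖ := (Finset.mul_sum _ _ _).symm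
    _ ≤ _ := mul_le_mul_of_nonneg_left (sum_mul_le_sqrt_mul_sqrt_of_le hQn hTn) (by positivity)

theorem section_trace_nonneg {H ι : Type*} [NormedAddCommGroup H] [InnerProductSpace ℂ H]
    (b : HilbertBasis ι ℂ H) {C : H →L[ℂ] H} (hC : C.IsPositive) {M : Matrix ι ι ℂ}
    (hM : M.PosSemidef) (S : Finset ι) :
    0 ≤ ∑ x ∈ S, ∑ y ∈ S, M x y * opMatrix b C y x := by
  obtain ⟨v, hv⟩ := exists_gram_section hM S
  rw [sum_mul_eq_sum_inner b C M S v hv]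
  exact Finset.sum_nonneg fun k _ => hC.inner_nonneg_right _

/-- No operator with matrix `M` is assumed: positivity and a summable diagonal suffice to make the
net Cauchy. This is what `ρ^PT` provides. -/
theorem exists_tendsto_section_trace {H I J : Type*} [NormedAddCommGroup H]
    [InnerProductSpace ℂ H] (b : HilbertBasis (I × J) ℂ H) (C : H →L[ℂ] H)
    {M : Matrix (I × J) (I × J) ℂ} (hM : M.PosSemidef) (hs : HasSum (fun x => (M x x).re) 1) :
    ∃ z : ℂ, Filter.Tendsto (fun S : Finset I × Finset J =>
      ∑ x ∈ S.1 ×ˢ S.2, ∑ y ∈ S.1 ×ˢ S.2, M x y * opMatrix b C y x) Filter.atTop (𝓝 z) := by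
  classical
  refine cauchySeq_tendsto_of_complete (Metric.cauchySeq_iff'.2 fun ε hε => ?_)
  have hnn : ∀ x, 0 ≤ (M x x).re := fun x => (Complex.nonneg_iff.1 hM.diag_nonneg).1
  -- The `+ 1` covers `C = 0` and makes the final inequality strict. The tail is taken below `δ ^ 2`
  -- because the estimate contains its square root.
  set δ : ℝ := ε / (2 * ‖C‖ + 1) with hδ
  have hδ0 : 0 < δ := by positivity
  obtain ⟨U, hU⟩ := summable_iff_vanishing_norm.1 hs.summable (δ ^ 2) (by positivity)
  refine ⟨(U.image Prod.fst, U.image Prod.snd), fun S hS => ?_⟩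
  have hUT : U ⊆ U.image Prod.fst ×ˢ U.image Prod.snd := fun x hx =>
    Finset.mem_product.2 ⟨Finset.mem_image_of_mem _ hx, Finset.mem_image_of_mem _ hx⟩
  rw [dist_eq_norm]
  refine (norm_section_trace_sub_le b C hM (Finset.product_subset_product hS.1 hS.2)).trans_lt ?_
  have h1 : √(∑ x ∈ (S.1 ×ˢ S.2) \ (U.image Prod.fst ×ˢ U.image Prod.snd), (M x x).re) ≤ δ := by
    refine Real.sqrt_le_iff.2 ⟨hδ0.le, ?_⟩
    refine (le_abs_self _).trans (hU _ ?_).le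
    exact Finset.disjoint_of_subset_right hUT Finset.sdiff_disjoint
  have h2 : √(∑ x ∈ S.1 ×ˢ S.2, (M x x).re) ≤ 1 :=
    Real.sqrt_le_one.2 (sum_le_hasSum _ (fun x _ => hnn x) hs)
  calc _ ≤ 2 * ‖C‖ * (δ * 1) := by gcongr
    _ < (2 * ‖C‖ + 1) * δ := by linarith
    _ = ε := by rw [hδ]; field_simp

theorem IsState.hasSum_re {H ι : Type*} [NormedAddCommGroup H] [InnerProductSpace ℂ H]
    {b : HilbertBasis ι ℂ H} {ρ : H →L[ℂ] H} (hρ : IsState b ρ) :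
    HasSum (fun x => (opMatrix b ρ x x).re) 1 := by
  simpa using Complex.hasSum_re hρ.2

theorem partialTranspose_apply_self {I J : Type*} (M : Matrix (I × J) (I × J) ℂ) (x : I × J) :
    partialTranspose M x x = M x x := rfl

theorem hasSum_re_diag_partialTranspose {I J : Type*} {M : Matrix (I × J) (I × J) ℂ} {r : ℝ}
    (h : HasSum (fun x => (M x x).re) r) : HasSum (fun x => (partialTranspose M x x).re) r := by
  simpa only [partialTranspose_apply_self] using h

theorem IsPPT.exists_hasTracePT {HA HB I J : Type*} [NormedAddCommGroup HA]
    [InnerProductSpace ℂ HA] [NormedAddCommGroup HB] [InnerProductSpace ℂ HB]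
    {e : HilbertBasis I ℂ HA} {f : HilbertBasis J ℂ HB}
    {ρ : HTensor HA HB →L[ℂ] HTensor HA HB} (hρ : IsState (prodBasis e f) ρ)
    (hP : IsPPT e f ρ) {C : HTensor HA HB →L[ℂ] HTensor HA HB} (hC : C.IsPositive) :
    ∃ t : ℝ, HasTracePT e f ρ C t ∧ 0 ≤ t := by
  classical
  have hs : HasSum (fun x => (partialTranspose (opMatrix (prodBasis e f) ρ) x x).re) 1 := by
    exact hasSum_re_diag_partialTranspose hρ.hasSum_re
  obtain ⟨z, hz⟩ := exists_tendsto_section_trace (prodBasis e f) C hP hs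
  -- In the complex order this also says that the limit is real.
  have hz0 : 0 ≤ z := ge_of_tendsto' hz fun S => section_trace_nonneg _ hC hP _
  obtain ⟨h0, him⟩ := Complex.nonneg_iff.1 hz0
  refine ⟨z.re, ?_, h0⟩
  have : ((z.re : ℝ) : ℂ) = z := Complex.ext rfl him
  simp only [HasTracePT, sum_mul_partialTranspose, this]
  exact hz

/-- The operator `|ψ⟩⟨ψ|` for `ψ` a finite combination of basis vectors tests positivity of the
partial transpose. -/
theorem isPPT_of_hasTracePT_nonneg {HA HB I J : Type*} [NormedAddCommGroup HA]
    [InnerProductSpace ℂ HA] [NormedAddCommGroup HB] [InnerProductSpace ℂ HB]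
    [CompleteSpace HA] [CompleteSpace HB]
    {e : HilbertBasis I ℂ HA} {f : HilbertBasis J ℂ HB}
    {ρ : HTensor HA HB →L[ℂ] HTensor HA HB} (hρ : ρ.IsPositive)
    (h : ∀ C : HTensor HA HB →L[ℂ] HTensor HA HB, C.IsPositive →
      ∃ t : ℝ, HasTracePT e f ρ C t ∧ 0 ≤ t) : IsPPT e f ρ := by
  classical
  have hherm : ∀ x y, star (opMatrix (prodBasis e f) ρ x y) = opMatrix (prodBasis e f) ρ y x :=
    fun x y => (inner_conj_symm _ _).trans (hρ.1 _ _)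
  refine ⟨?_, fun φ => ?_⟩
  · ext x y
    exact hherm _ _
  set ψ : HTensor HA HB := combo (prodBasis e f) φ.support φ with hψ
  have hψi : ∀ x, ⟪prodBasis e f x, ψ⟫_ℂ = φ x := fun x => by
    rw [hψ, combo]
    by_cases hx : x ∈ φ.support
    · exact (prodBasis e f).orthonormal.inner_right_sum _ hx
    · rw [inner_sum, Finsupp.notMem_support_iff.1 hx]
      refine Finset.sum_eq_zero fun y hy => ?_
      rw [inner_smul_right, (prodBasis e f).orthonormal.inner_eq_zero (by grind), mul_zero]
  have hCm : ∀ x y, opMatrix (prodBasis e f) (InnerProductSpace.rankOne ℂ ψ ψ) x y =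
      φ x * star (φ y) := fun x y => by
    rw [opMatrix, Matrix.of_apply, InnerProductSpace.rankOne_apply, inner_smul_right, hψi,
      ← inner_conj_symm, hψi, mul_comm, starRingEnd_apply]
  obtain ⟨t, ht, ht0⟩ := h (InnerProductSpace.rankOne ℂ ψ ψ)
    (InnerProductSpace.isPositive_rankOne_self ψ)
  simp only [HasTracePT, sum_mul_partialTranspose] at ht
  -- The net is constant once the rectangle contains the support of `φ`, so its limit is the
  -- quadratic form itself.
  have hev : ∀ᶠ S : Finset I × Finset J in Filter.atTop,
      (∑ x ∈ S.1 ×ˢ S.2, ∑ y ∈ S.1 ×ˢ S.2,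
        partialTranspose (opMatrix (prodBasis e f) ρ) x y *
          opMatrix (prodBasis e f) (InnerProductSpace.rankOne ℂ ψ ψ) y x) =
      φ.sum fun i xi => φ.sum fun j xj =>
        star xi * partialTranspose (opMatrix (prodBasis e f) ρ) i j * xj := by
    filter_upwards [tendsto_rectangle.eventually (Filter.eventually_ge_atTop φ.support)] with S hS
    rw [φ.sum_of_support_subset hS _ (by simp)]
    refine Finset.sum_congr rfl fun x _ => ?_
    rw [φ.sum_of_support_subset hS _ (by simp)]
    refine Finset.sum_congr rfl fun y _ => ?_
    rw [hCm]
    ring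
  have := tendsto_nhds_unique (tendsto_const_nhds.congr' (hev.mono fun _ h => h.symm)) ht
  rw [this]
  exact_mod_cast ht0

/-! ### Positive partial transpose excludes distillability -/

/-- Schur product theorem, by induction on `s`; the empty product is the all-ones matrix, a pullback
of the `1 × 1` identity. -/
theorem posSemidef_prod_comp {ι κ ι' : Type*} {M : Matrix ι ι ℂ} (hM : M.PosSemidef)
    (g : κ → ι' → ι) (s : Finset κ) :
    (Matrix.of fun x y : ι' => ∏ k ∈ s, M (g k x) (g k y)).PosSemidef := by
  classical
  induction s using Finset.induction_on with
  | empty => simpa using! (Matrix.PosSemidef.one (n := Unit) (R := ℂ)).submatrix fun _ : ι' => ()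
  | insert k s hk ih =>
    have h : (Matrix.of fun x y : ι' => ∏ k ∈ insert k s, M (g k x) (g k y)) =
        (M.submatrix (g k) (g k)).hadamard (Matrix.of fun x y => ∏ k ∈ s, M (g k x) (g k y)) := by
      ext x y
      simp [Finset.prod_insert hk]
    rw [h]
    exact (hM.submatrix (g k)).hadamard ih

/-- Partial transposition acts on each copy separately, so the transposed matrix of `R` is an
entrywise product of pullbacks of `ρ^PT`. -/
theorem IsPPT.copies {HA HB I J : Type*} [NormedAddCommGroup HA]
    [InnerProductSpace ℂ HA] [NormedAddCommGroup HB] [InnerProductSpace ℂ HB]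
    {e : HilbertBasis I ℂ HA} {f : HilbertBasis J ℂ HB}
    {ρ : HTensor HA HB →L[ℂ] HTensor HA HB} (hP : IsPPT e f ρ) {n : ℕ}
    {R : HTensor (L2 (Fin n → I)) (L2 (Fin n → J)) →L[ℂ]
      HTensor (L2 (Fin n → I)) (L2 (Fin n → J))} (hR : IsCopies e f ρ n R) :
    IsPPT (stdBasis (Fin n → I)) (stdBasis (Fin n → J)) R := by
  have h := posSemidef_prod_comp hP
    (fun (k : Fin n) (x : (Fin n → I) × (Fin n → J)) => (x.1 k, x.2 k)) Finset.univ
  unfold IsPPT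
  convert h using 1
  ext x y
  exact hR x.1 y.1 y.2 x.2

theorem sectionForm_cross_le {ι : Type*} {M : Matrix ι ι ℂ} (hM : M.PosSemidef) (S : Finset ι)
    (φ ψ : ι → ℂ) :
    sectionForm M S φ ψ + sectionForm M S ψ φ ≤ sectionForm M S φ φ + sectionForm M S ψ ψ := by
  have h := sectionForm_nonneg hM S (φ - ψ)
  have h2 : sectionForm M S (φ - ψ) (φ - ψ) = sectionForm M S φ φ + sectionForm M S ψ ψ -
      (sectionForm M S φ ψ + sectionForm M S ψ φ) := by
    simp only [sectionForm, ← Finset.sum_add_distrib, ← Finset.sum_sub_distrib, Pi.sub_apply,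
      star_sub]
    exact Finset.sum_congr rfl fun x _ => Finset.sum_congr rfl fun y _ => by ring
  rw [h2] at h
  exact sub_nonneg.1 h

/-- Positivity of the partial transpose, tested at `|a, d̄⟩ - |c, b̄⟩`. -/
theorem IsPPT.cross_le {KA KB I J : Type*} [NormedAddCommGroup KA]
    [InnerProductSpace ℂ KA] [NormedAddCommGroup KB] [InnerProductSpace ℂ KB]
    {e : HilbertBasis I ℂ KA} {f : HilbertBasis J ℂ KB}
    {R : HTensor KA KB →L[ℂ] HTensor KA KB} (hP : IsPPT e f R) (a c : KA) (b d : KB) :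
    ⟪ket a b, R (ket c d)⟫_ℂ + ⟪ket c d, R (ket a b)⟫_ℂ ≤
      ⟪ket a d, R (ket a d)⟫_ℂ + ⟪ket c b, R (ket c b)⟫_ℂ := by
  classical
  refine le_of_tendsto_of_tendsto'
    ((tendsto_sectionForm_tprod e f R a c b d).add (tendsto_sectionForm_tprod e f R c a d b))
    ((tendsto_sectionForm_tprod e f R a a d d).add (tendsto_sectionForm_tprod e f R c c b b))
    fun S => ?_
  -- After transposition the cross terms pair `a ⊗ d̄` with `c ⊗ b̄`, and the other two are the
  -- diagonal terms of these same vectors.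
  rw [sectionForm_partialTranspose, sectionForm_partialTranspose S.1 S.2 _ (fun i => ⟪e i, c⟫_ℂ),
    sectionForm_partialTranspose S.1 S.2 _ (fun i => ⟪e i, a⟫_ℂ) (fun i => ⟪e i, a⟫_ℂ),
    sectionForm_partialTranspose S.1 S.2 _ (fun i => ⟪e i, c⟫_ℂ) (fun i => ⟪e i, c⟫_ℂ)]
  exact sectionForm_cross_le hP _ _ _

/-- The coherences between `00` and `11` are dominated by the populations of `01` and `10`, which
complete those of `00` and `11` to the trace. -/
theorem IsPPT.singletOverlap_le {KA KB I J : Type*} [NormedAddCommGroup KA]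
    [InnerProductSpace ℂ KA] [CompleteSpace KA] [NormedAddCommGroup KB] [InnerProductSpace ℂ KB]
    [CompleteSpace KB] {e : HilbertBasis I ℂ KA} {f : HilbertBasis J ℂ KB}
    {R : HTensor KA KB →L[ℂ] HTensor KA KB} (hP : IsPPT e f R) {m : ℕ}
    (A : Fin m → KA →L[ℂ] Qubit) (B : Fin m → KB →L[ℂ] Qubit) :
    singletOverlap (localOutput A B R) ≤ (localOutput A B R).trace.re / 2 := by
  have key : ∑ s : Fin 2, ∑ t : Fin 2, localOutput A B R (s, s) (t, t) ≤
      (localOutput A B R).trace := by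
    simp only [Matrix.trace, Matrix.diag, Fintype.sum_prod_type, Fin.sum_univ_two, localOutput,
      Matrix.of_apply, ← Finset.sum_add_distrib]
    refine Finset.sum_le_sum fun k _ => ?_
    have h := hP.cross_le ((A k).adjoint (EuclideanSpace.single 0 1))
      ((A k).adjoint (EuclideanSpace.single 1 1)) ((B k).adjoint (EuclideanSpace.single 0 1))
      ((B k).adjoint (EuclideanSpace.single 1 1))
    linear_combination h
  have h2 := (Complex.le_def.1 key).1
  unfold singletOverlap
  rw [show (2 : ℂ) = ((2 : ℝ) : ℂ) by norm_num, Complex.div_ofReal_re]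
  linarith

theorem IsPPT.not_isDistillable {HA HB I J : Type*} [NormedAddCommGroup HA]
    [InnerProductSpace ℂ HA] [NormedAddCommGroup HB] [InnerProductSpace ℂ HB]
    {e : HilbertBasis I ℂ HA} {f : HilbertBasis J ℂ HB}
    {ρ : HTensor HA HB →L[ℂ] HTensor HA HB} (hP : IsPPT e f ρ) : ¬ IsDistillable e f ρ := by
  intro h
  -- Any `ε < 1 / 2` contradicts the overlap bound.
  obtain ⟨n, R, hR, m, A, B, h0, h1⟩ := h (1 / 4) (by norm_num)
  have := (hP.copies hR).singletOverlap_le A B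
  linarith

/-! ### Separable states violate the witness inequality -/

/-- Reconciles the real scalars of `convexHull ℝ` with the complex scalars used for operators; both
actions are continuous and agree on a dense subspace. -/
theorem completion_real_smul {E : Type*} [NormedAddCommGroup E] [InnerProductSpace ℂ E] (r : ℝ)
    (w : UniformSpace.Completion E) : r • w = (r : ℂ) • w := by
  induction w using UniformSpace.Completion.induction_on with
  | hp => exact isClosed_eq (continuous_const_smul r) (continuous_const_smul (r : ℂ))
  | ih w => rw [← UniformSpace.Completion.coe_smul, ← UniformSpace.Completion.coe_smul]; rfl

set_option synthInstance.maxHeartbeats 400000 in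
theorem real_smul_op {HA HB : Type*} [NormedAddCommGroup HA] [InnerProductSpace ℂ HA]
    [NormedAddCommGroup HB] [InnerProductSpace ℂ HB] (r : ℝ)
    (T : HTensor HA HB →L[ℂ] HTensor HA HB) : r • T = (r : ℂ) • T := by
  ext v
  exact completion_real_smul r (T v)

set_option synthInstance.maxHeartbeats 400000 in
theorem convexHull_pure_induction {HA HB : Type*} [NormedAddCommGroup HA] [InnerProductSpace ℂ HA]
    [NormedAddCommGroup HB] [InnerProductSpace ℂ HB]
    {P : (HTensor HA HB →L[ℂ] HTensor HA HB) → Prop}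
    (hpure : ∀ (a : HA) (b : HB), ‖a‖ = 1 → ‖b‖ = 1 →
      P (InnerProductSpace.rankOne ℂ (ket a b) (ket a b)))
    (hconv : ∀ T T' (p q : ℝ), 0 ≤ p → 0 ≤ q → p + q = 1 → P T → P T' →
      P ((p : ℂ) • T + (q : ℂ) • T'))
    {σ : HTensor HA HB →L[ℂ] HTensor HA HB} (hσ : σ ∈ convexHull ℝ (pureProductStates HA HB)) :
    P σ := by
  refine convexHull_min (t := {T | P T}) ?_ ?_ hσ
  · rintro _ ⟨a, b, ha, hb, rfl⟩
    exact hpure a b ha hb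
  · intro T hT T' hT' p q hp hq hpq
    rw [real_smul_op, real_smul_op]
    exact hconv T T' p q hp hq hpq hT hT'

set_option synthInstance.maxHeartbeats 400000 in
theorem smul_add_smul_mem_convexHull_pure {HA HB : Type*} [NormedAddCommGroup HA]
    [InnerProductSpace ℂ HA] [NormedAddCommGroup HB] [InnerProductSpace ℂ HB]
    {σ τ : HTensor HA HB →L[ℂ] HTensor HA HB} (hσ : σ ∈ convexHull ℝ (pureProductStates HA HB))
    (hτ : τ ∈ convexHull ℝ (pureProductStates HA HB)) {p q : ℝ} (hp : 0 ≤ p) (hq : 0 ≤ q)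
    (hpq : p + q = 1) : (p : ℂ) • σ + (q : ℂ) • τ ∈ convexHull ℝ (pureProductStates HA HB) := by
  rw [← real_smul_op, ← real_smul_op]
  exact convex_convexHull ℝ _ hσ hτ hp hq hpq

theorem infProduct_bddBelow {HA HB : Type*} [NormedAddCommGroup HA] [InnerProductSpace ℂ HA]
    [NormedAddCommGroup HB] [InnerProductSpace ℂ HB]
    {C : HTensor HA HB →L[ℂ] HTensor HA HB} (hC : C.IsPositive) :
    BddBelow {r : ℝ | ∃ (a : HA) (b : HB), ‖a‖ = 1 ∧ ‖b‖ = 1 ∧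
      r = (⟪ket a b, C (ket a b)⟫_ℂ).re} := by
  refine ⟨0, ?_⟩
  rintro r ⟨a, b, -, -, rfl⟩
  exact hC.re_inner_nonneg_right _

/-- Homogeneity extends the bound to vectors that are not normalized, as arises for truncations of
unit vectors. -/
theorem infProduct_mul_le {HA HB : Type*} [NormedAddCommGroup HA] [InnerProductSpace ℂ HA]
    [NormedAddCommGroup HB] [InnerProductSpace ℂ HB]
    {C : HTensor HA HB →L[ℂ] HTensor HA HB} (hC : C.IsPositive) (a : HA) (b : HB) :
    infProduct C * (‖a‖ ^ 2 * ‖b‖ ^ 2) ≤ (⟪ket a b, C (ket a b)⟫_ℂ).re := by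
  rcases eq_or_ne a 0 with rfl | ha
  · simpa using hC.re_inner_nonneg_right _
  rcases eq_or_ne b 0 with rfl | hb
  · simpa using hC.re_inner_nonneg_right _
  have hna : ‖a‖ ≠ 0 := norm_ne_zero_iff.2 ha
  have hnb : ‖b‖ ≠ 0 := norm_ne_zero_iff.2 hb
  set r : ℂ := ((‖a‖⁻¹ : ℝ) : ℂ) with hr
  set s : ℂ := ((‖b‖⁻¹ : ℝ) : ℂ) with hs
  have hle : infProduct C ≤ (⟪ket (r • a) (s • b), C (ket (r • a) (s • b))⟫_ℂ).re :=
    csInf_le (infProduct_bddBelow hC) ⟨r • a, s • b,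
      by rw [norm_smul, hr, Complex.norm_real, norm_inv, norm_norm, inv_mul_cancel₀ hna],
      by rw [norm_smul, hs, Complex.norm_real, norm_inv, norm_norm, inv_mul_cancel₀ hnb], rfl⟩
  have hk : ket (r • a) (s • b) = (((‖a‖⁻¹ * ‖b‖⁻¹ : ℝ)) : ℂ) • (ket a b : HTensor HA HB) := by
    rw [← ketₗ_apply, map_smul, map_smul, LinearMap.smul_apply, smul_smul, ketₗ_apply,
      hr, hs, Complex.ofReal_mul, mul_comm]
  rw [hk, map_smul, inner_smul_left, inner_smul_right, Complex.conj_ofReal, Complex.re_ofReal_mul,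
    Complex.re_ofReal_mul] at hle
  calc _ ≤ (‖a‖⁻¹ * ‖b‖⁻¹ * (‖a‖⁻¹ * ‖b‖⁻¹ * (⟪ket a b, C (ket a b)⟫_ℂ).re)) *
        (‖a‖ ^ 2 * ‖b‖ ^ 2) := mul_le_mul_of_nonneg_right hle (by positivity)
    _ = _ := by field_simp

theorem TraceNormLE.norm_inner_le {H : Type*} [NormedAddCommGroup H] [InnerProductSpace ℂ H]
    {T : H →L[ℂ] H} {r : ℝ} (h : TraceNormLE T r) {u v : H} (hu : ‖u‖ = 1) (hv : ‖v‖ = 1) :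
    ‖⟪u, T v⟫_ℂ‖ ≤ r := by
  have := h 1 (fun _ => u) (fun _ => v) (by simp [hu])
    (by simp [hv])
  simpa using this

/-- The excess of the truncated value of `tr (ρ C^PT)` over `m * tr ρ`, also truncated. -/
def witnessExcess {I J : Type*} (N : Matrix (I × J) (I × J) ℂ) (m : ℝ) (F : Finset I)
    (G : Finset J) (M : Matrix (I × J) (I × J) ℂ) : ℝ :=
  (∑ x ∈ F ×ˢ G, ∑ y ∈ F ×ˢ G, M x y * partialTranspose N y x - m * ∑ x ∈ F ×ˢ G, M x x).re

theorem continuous_witnessExcess {I J : Type*} (N : Matrix (I × J) (I × J) ℂ) (m : ℝ)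
    (F : Finset I) (G : Finset J) : Continuous (witnessExcess N m F G) := by
  unfold witnessExcess
  have h : ∀ x y : I × J, Continuous fun M : Matrix (I × J) (I × J) ℂ => M x y :=
    fun x y => (continuous_apply y).comp (continuous_apply x)
  fun_prop

theorem witnessExcess_smul_add_smul {I J : Type*} (N : Matrix (I × J) (I × J) ℂ) (m : ℝ)
    (F : Finset I) (G : Finset J) (p q : ℝ) (M M' : Matrix (I × J) (I × J) ℂ) :
    witnessExcess N m F G ((p : ℂ) • M + (q : ℂ) • M') =
      p * witnessExcess N m F G M + q * witnessExcess N m F G M' := by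
  unfold witnessExcess
  rw [← Complex.re_ofReal_mul, ← Complex.re_ofReal_mul, ← Complex.add_re]
  simp only [Matrix.add_apply, Matrix.smul_apply, smul_eq_mul, add_mul, Finset.sum_add_distrib,
    mul_assoc, ← Finset.mul_sum]
  congr 1
  ring

theorem opMatrix_smul_add_smul {H ι : Type*} [NormedAddCommGroup H] [InnerProductSpace ℂ H]
    (b : HilbertBasis ι ℂ H) (p q : ℂ) (T T' : H →L[ℂ] H) :
    opMatrix b (p • T + q • T') = p • opMatrix b T + q • opMatrix b T' := by
  ext x y
  simp [opMatrix]

theorem opMatrix_rankOne {H ι : Type*} [NormedAddCommGroup H] [InnerProductSpace ℂ H]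
    (b : HilbertBasis ι ℂ H) (u v : H) (x y : ι) :
    opMatrix b (InnerProductSpace.rankOne ℂ u v) x y = ⟪b x, u⟫_ℂ * star ⟪b y, v⟫_ℂ := by
  rw [opMatrix, Matrix.of_apply, InnerProductSpace.rankOne_apply, inner_smul_right,
    ← inner_conj_symm v, mul_comm, starRingEnd_apply]

/-- Entries of the product state. -/
theorem opMatrix_rankOne_ket {HA HB I J : Type*} [NormedAddCommGroup HA] [InnerProductSpace ℂ HA]
    [NormedAddCommGroup HB] [InnerProductSpace ℂ HB] (e : HilbertBasis I ℂ HA)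
    (f : HilbertBasis J ℂ HB) (a : HA) (b : HB) (x y : I × J) :
    opMatrix (prodBasis e f) (InnerProductSpace.rankOne ℂ (ket a b) (ket a b)) x y =
      tprod (fun i => ⟪e i, a⟫_ℂ) (fun j => ⟪f j, b⟫_ℂ) x *
        star (tprod (fun i => ⟪e i, a⟫_ℂ) (fun j => ⟪f j, b⟫_ℂ) y) := by
  rw [opMatrix_rankOne, prodBasis_apply, prodBasis_apply, inner_ket, inner_ket]
  rfl

theorem sum_rankOne_mul {ι : Type*} (N : Matrix ι ι ℂ) (S : Finset ι) (φ : ι → ℂ) :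
    ∑ x ∈ S, ∑ y ∈ S, φ x * star (φ y) * N y x = sectionForm N S φ φ := by
  rw [Finset.sum_comm]
  exact Finset.sum_congr rfl fun x _ => Finset.sum_congr rfl fun y _ => by ring

theorem witnessExcess_nonneg_of_tprod {HA HB I J : Type*} [NormedAddCommGroup HA]
    [InnerProductSpace ℂ HA] [NormedAddCommGroup HB] [InnerProductSpace ℂ HB]
    (e : HilbertBasis I ℂ HA) (f : HilbertBasis J ℂ HB)
    {C : HTensor HA HB →L[ℂ] HTensor HA HB} (hC : C.IsPositive) (F : Finset I) (G : Finset J)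
    (α : I → ℂ) (β : J → ℂ) {M : Matrix (I × J) (I × J) ℂ}
    (hM : ∀ x y, M x y = tprod α β x * star (tprod α β y)) :
    0 ≤ witnessExcess (opMatrix (prodBasis e f) C) (infProduct C) F G M := by
  -- The conjugate `star β` appears because transposing `C` back conjugates the second factor.
  have h := infProduct_mul_le hC (combo e F α) (combo f G (star β))
  rw [ket_combo, inner_combo_apply_combo, norm_combo_sq e.orthonormal,
    norm_combo_sq f.orthonormal, Finset.sum_mul_sum, ← Finset.sum_product'] at h
  have h1 : ∑ x ∈ F ×ˢ G, M x x = ((∑ x ∈ F ×ˢ G, ‖α x.1‖ ^ 2 * ‖(star β) x.2‖ ^ 2 : ℝ) : ℂ) := by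
    rw [Complex.ofReal_sum]
    refine Finset.sum_congr rfl fun x _ => ?_
    rw [hM, Complex.star_def, Complex.mul_conj, Complex.normSq_eq_norm_sq, tprod, norm_mul,
      Pi.star_apply, norm_star, mul_pow]
  unfold witnessExcess
  rw [h1, ← Complex.ofReal_mul, Complex.sub_re, Complex.ofReal_re, sub_nonneg]
  simp only [hM]
  rw [sum_rankOne_mul, sectionForm_partialTranspose, partialTranspose_partialTranspose]
  exact h

/-- On a fixed rectangle the excess depends continuously on finitely many entries, so trace-norm
approximation is used only entrywise. The rectangles grow after the passage to `ρ`; boundedness of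
`C^PT` is never needed. -/
theorem IsSeparable.infProduct_le {HA HB I J : Type*} [NormedAddCommGroup HA]
    [InnerProductSpace ℂ HA] [NormedAddCommGroup HB] [InnerProductSpace ℂ HB]
    {e : HilbertBasis I ℂ HA} {f : HilbertBasis J ℂ HB}
    {ρ : HTensor HA HB →L[ℂ] HTensor HA HB} (hρ : IsState (prodBasis e f) ρ)
    (hs : IsSeparable ρ) {C : HTensor HA HB →L[ℂ] HTensor HA HB} (hC : C.IsPositive) {t : ℝ}
    (ht : HasTracePT e f ρ C t) : infProduct C ≤ t := by
  classical
  choose σ hσ hσε using fun n : ℕ => hs (1 / ((n : ℝ) + 1)) (by positivity)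
  have hlim : Filter.Tendsto (fun n => opMatrix (prodBasis e f) (σ n)) Filter.atTop
      (𝓝 (opMatrix (prodBasis e f) ρ)) := by
    refine tendsto_pi_nhds.2 fun x => tendsto_pi_nhds.2 fun y => ?_
    refine tendsto_iff_norm_sub_tendsto_zero.2 (squeeze_zero (fun _ => norm_nonneg _) (fun n => ?_)
      tendsto_one_div_add_atTop_nhds_zero_nat)
    have := (hσε n).norm_inner_le ((prodBasis e f).orthonormal.1 x)
      ((prodBasis e f).orthonormal.1 y)
    rwa [sub_apply, inner_sub_right, norm_sub_rev] at this
  have hconv : ∀ F G, ∀ τ ∈ convexHull ℝ (pureProductStates HA HB),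
      0 ≤ witnessExcess (opMatrix (prodBasis e f) C) (infProduct C) F G
        (opMatrix (prodBasis e f) τ) := by
    intro F G τ hτ
    refine convexHull_pure_induction (P := fun T => 0 ≤ witnessExcess (opMatrix (prodBasis e f) C)
      (infProduct C) F G (opMatrix (prodBasis e f) T)) (fun a b _ _ => ?_)
      (fun T T' p q hp hq _ hT hT' => ?_) hτ
    · exact witnessExcess_nonneg_of_tprod e f hC F G _ _ (opMatrix_rankOne_ket e f a b)
    · rw [opMatrix_smul_add_smul, witnessExcess_smul_add_smul]
      positivity
  have hfin : ∀ F G, 0 ≤ witnessExcess (opMatrix (prodBasis e f) C) (infProduct C) F G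
      (opMatrix (prodBasis e f) ρ) := fun F G =>
    ge_of_tendsto' (((continuous_witnessExcess _ _ F G).tendsto _).comp hlim)
      fun n => hconv F G _ (hσ n)
  have htr : Filter.Tendsto (fun S : Finset I × Finset J =>
      ∑ x ∈ S.1 ×ˢ S.2, opMatrix (prodBasis e f) ρ x x) Filter.atTop (𝓝 1) := by
    have h : Filter.Tendsto (fun S : Finset (I × J) => ∑ x ∈ S, opMatrix (prodBasis e f) ρ x x)
      Filter.atTop (𝓝 1) := by simpa only [HasSum, SummationFilter.unconditional_filter] using hρ.2
    exact h.comp tendsto_rectangle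
  have hall := (Complex.continuous_re.tendsto _).comp
    (Filter.Tendsto.sub ht (htr.const_mul (infProduct C : ℂ)))
  have h0 := ge_of_tendsto' hall fun S => hfin S.1 S.2
  simpa using h0

/-! ### Trace norm estimates -/

theorem TraceNormLE.mono {H : Type*} [NormedAddCommGroup H] [InnerProductSpace ℂ H]
    {T : H →L[ℂ] H} {r s : ℝ} (h : TraceNormLE T r) (hrs : r ≤ s) : TraceNormLE T s :=
  fun n u v hu hv => (h n u v hu hv).trans hrs

theorem traceNormLE_zero {H : Type*} [NormedAddCommGroup H] [InnerProductSpace ℂ H] :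
    TraceNormLE (0 : H →L[ℂ] H) 0 := fun n u v _ _ => by simp

theorem TraceNormLE.add {H : Type*} [NormedAddCommGroup H] [InnerProductSpace ℂ H]
    {T T' : H →L[ℂ] H} {r r' : ℝ} (h : TraceNormLE T r) (h' : TraceNormLE T' r') :
    TraceNormLE (T + T') (r + r') := fun n u v hu hv => by
  refine le_trans ?_ (add_le_add (h n u v hu hv) (h' n u v hu hv))
  rw [← Finset.sum_add_distrib]
  refine Finset.sum_le_sum fun k _ => ?_
  rw [add_apply, inner_add_right]
  exact norm_add_le _ _

theorem TraceNormLE.smul {H : Type*} [NormedAddCommGroup H] [InnerProductSpace ℂ H]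
    {T : H →L[ℂ] H} {r : ℝ} (h : TraceNormLE T r) (c : ℂ) :
    TraceNormLE (c • T) (‖c‖ * r) := fun n u v hu hv => by
  refine le_trans (le_of_eq ?_) (mul_le_mul_of_nonneg_left (h n u v hu hv) (norm_nonneg c))
  rw [Finset.mul_sum]
  refine Finset.sum_congr rfl fun k _ => ?_
  rw [smul_apply, inner_smul_right, norm_mul]

theorem traceNormLE_sum {H ι : Type*} [NormedAddCommGroup H] [InnerProductSpace ℂ H]
    (s : Finset ι) {T : ι → H →L[ℂ] H} {r : ι → ℝ} (h : ∀ i ∈ s, TraceNormLE (T i) (r i)) :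
    TraceNormLE (∑ i ∈ s, T i) (∑ i ∈ s, r i) := by
  classical
  induction s using Finset.induction_on with
  | empty => simpa using traceNormLE_zero
  | insert i s hi ih =>
    rw [Finset.sum_insert hi, Finset.sum_insert hi]
    exact (h i (Finset.mem_insert_self _ _)).add
      (ih fun j hj => h j (Finset.mem_insert_of_mem hj))

/-- Cauchy–Schwarz over `k`, then Bessel's inequality for each family. -/
theorem traceNormLE_rankOne {H : Type*} [NormedAddCommGroup H] [InnerProductSpace ℂ H]
    (x y : H) : TraceNormLE (InnerProductSpace.rankOne ℂ x y) (‖x‖ * ‖y‖) := fun n u v hu hv => by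
  calc _ = ∑ k, ‖⟪u k, x⟫_ℂ‖ * ‖⟪v k, y⟫_ℂ‖ := Finset.sum_congr rfl fun k _ => by
        rw [InnerProductSpace.rankOne_apply, inner_smul_right, norm_mul, norm_inner_symm y,
          mul_comm]
    _ ≤ √(‖x‖ ^ 2) * √(‖y‖ ^ 2) :=
        sum_mul_le_sqrt_mul_sqrt_of_le (hu.sum_inner_products_le x) (hv.sum_inner_products_le y)
    _ = _ := by rw [Real.sqrt_sq (norm_nonneg _), Real.sqrt_sq (norm_nonneg _)]

theorem traceNormLE_of_mem_convexHull_pure {HA HB : Type*} [NormedAddCommGroup HA]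
    [InnerProductSpace ℂ HA] [NormedAddCommGroup HB] [InnerProductSpace ℂ HB]
    {σ : HTensor HA HB →L[ℂ] HTensor HA HB} (hσ : σ ∈ convexHull ℝ (pureProductStates HA HB)) :
    TraceNormLE σ 1 := by
  refine convexHull_pure_induction (P := fun σ => TraceNormLE σ 1) (fun a b ha hb => ?_)
    (fun T T' p q hp hq hpq hT hT' => ?_) hσ
  · simpa [norm_ket, ha, hb] using traceNormLE_rankOne (ket a b : HTensor HA HB) (ket a b)
  · refine ((hT.smul p).add (hT'.smul q)).mono (le_of_eq ?_)
    rw [Complex.norm_of_nonneg hp, Complex.norm_of_nonneg hq, mul_one, mul_one, hpq]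

theorem ofReal_norm_sq_eq_tsum {H ι : Type*} [NormedAddCommGroup H] [InnerProductSpace ℂ H]
    (b : HilbertBasis ι ℂ H) (v : H) :
    ENNReal.ofReal (‖v‖ ^ 2) = ∑' x, ENNReal.ofReal (‖⟪b x, v⟫_ℂ‖ ^ 2) := by
  have h : HasSum (fun x => ‖⟪b x, v⟫_ℂ‖ ^ 2) (‖v‖ ^ 2) := by
    have h1 := Complex.hasSum_re (b.hasSum_inner_mul_inner v v)
    rw [inner_self_eq_norm_sq_to_K] at h1
    convert h1 using 1
    · ext x
      rw [← inner_conj_symm v, RCLike.conj_mul]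
      norm_cast
    · norm_cast
  rw [← h.tsum_eq, ENNReal.ofReal_tsum_of_nonneg (fun _ => by positivity) h.summable]

/-- The Hilbert-Schmidt norm bounds the sum over an orthonormal family. -/
theorem sum_norm_sq_apply_le {H ι : Type*} [NormedAddCommGroup H] [InnerProductSpace ℂ H]
    [CompleteSpace H] (b : HilbertBasis ι ℂ H) (T : H →L[ℂ] H) {s : ℝ}
    (hs : HasSum (fun x => ‖T (b x)‖ ^ 2) s) {n : ℕ} {u : Fin n → H} (hu : Orthonormal ℂ u) :
    ∑ k, ‖T (u k)‖ ^ 2 ≤ s := by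
  have hs0 : 0 ≤ s := hs.nonneg fun _ => by positivity
  -- In `ENNReal` double sums may be exchanged freely. Bessel for `u` bounds the sum by the
  -- Hilbert–Schmidt norm of the adjoint, and Parseval identifies that with the norm of `T`.
  rw [← ENNReal.ofReal_le_ofReal_iff hs0, ENNReal.ofReal_sum_of_nonneg fun _ _ => by positivity]
  calc ∑ k, ENNReal.ofReal (‖T (u k)‖ ^ 2)
      = ∑ k, ∑' x, ENNReal.ofReal (‖⟪u k, T.adjoint (b x)⟫_ℂ‖ ^ 2) :=
        Finset.sum_congr rfl fun k _ => by
          rw [ofReal_norm_sq_eq_tsum b]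
          refine tsum_congr fun x => ?_
          rw [norm_inner_symm, ContinuousLinearMap.adjoint_inner_right]
    _ = ∑' x, ∑ k, ENNReal.ofReal (‖⟪u k, T.adjoint (b x)⟫_ℂ‖ ^ 2) :=
        (Summable.tsum_finsetSum fun _ _ => ENNReal.summable).symm
    _ ≤ ∑' x, ENNReal.ofReal (‖T.adjoint (b x)‖ ^ 2) := ENNReal.tsum_le_tsum fun x => by
        rw [← ENNReal.ofReal_sum_of_nonneg fun _ _ => by positivity]
        exact ENNReal.ofReal_le_ofReal (hu.sum_inner_products_le _)
    _ = ∑' x, ∑' y, ENNReal.ofReal (‖⟪b y, T.adjoint (b x)⟫_ℂ‖ ^ 2) :=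
        tsum_congr fun x => ofReal_norm_sq_eq_tsum b _
    _ = ∑' y, ∑' x, ENNReal.ofReal (‖⟪b y, T.adjoint (b x)⟫_ℂ‖ ^ 2) := ENNReal.tsum_comm
    _ = ∑' y, ENNReal.ofReal (‖T (b y)‖ ^ 2) := tsum_congr fun y => by
        rw [ofReal_norm_sq_eq_tsum b]
        refine tsum_congr fun x => ?_
        rw [norm_inner_symm (b x), ContinuousLinearMap.adjoint_inner_right]
    _ = ENNReal.ofReal s := by
        rw [← ENNReal.ofReal_tsum_of_nonneg (fun _ => by positivity) hs.summable, hs.tsum_eq]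

/-- The operator with a given finite section. -/
def sectionOp {H ι : Type*} [NormedAddCommGroup H] [InnerProductSpace ℂ H]
    (b : ι → H) (S : Finset ι) (M : Matrix ι ι ℂ) : H →L[ℂ] H :=
  ∑ x ∈ S, ∑ y ∈ S, M x y • InnerProductSpace.rankOne ℂ (b x) (b y)

theorem inner_sectionOp {H ι : Type*} [NormedAddCommGroup H] [InnerProductSpace ℂ H]
    (b : ι → H) (S : Finset ι) (M : Matrix ι ι ℂ) (u v : H) :
    ⟪u, sectionOp b S M v⟫_ℂ = sectionForm M S (fun x => ⟪b x, u⟫_ℂ) (fun x => ⟪b x, v⟫_ℂ) := by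
  simp only [sectionOp, sectionForm, sum_apply, smul_apply, inner_sum, inner_smul_right,
    InnerProductSpace.rankOne_apply]
  refine Finset.sum_congr rfl fun x _ => Finset.sum_congr rfl fun y _ => ?_
  rw [← inner_conj_symm u, starRingEnd_apply]
  ring

theorem traceNormLE_sectionOp {H ι : Type*} [NormedAddCommGroup H] [InnerProductSpace ℂ H]
    {b : ι → H} (hb : Orthonormal ℂ b) (S : Finset ι) (M : Matrix ι ι ℂ) :
    TraceNormLE (sectionOp b S M) (∑ x ∈ S, ∑ y ∈ S, ‖M x y‖) :=
  traceNormLE_sum _ fun x _ => traceNormLE_sum _ fun y _ => by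
    simpa [hb.1 x, hb.1 y] using (traceNormLE_rankOne (b x) (b y)).smul (M x y)

/-- With `W` the square root, the trace of `ρ` becomes a squared Hilbert–Schmidt norm, to which
Cauchy–Schwarz applies. -/
theorem exists_sqrt_of_isPositive {H : Type*} [NormedAddCommGroup H] [InnerProductSpace ℂ H]
    [CompleteSpace H] {ρ : H →L[ℂ] H} (hρ : ρ.IsPositive) :
    ∃ W : H →L[ℂ] H, ∀ u v, ⟪u, ρ v⟫_ℂ = ⟪W u, W v⟫_ℂ := by
  have h0 : 0 ≤ ρ := (ContinuousLinearMap.nonneg_iff_isPositive ρ).2 hρ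
  refine ⟨CFC.sqrt ρ, fun u v => ?_⟩
  have hW := (ContinuousLinearMap.nonneg_iff_isPositive _).1 (CFC.sqrt_nonneg ρ)
  conv_lhs => rw [← CFC.sqrt_mul_sqrt_self ρ h0]
  exact (hW.1 u (CFC.sqrt ρ v)).symm

/-- A state is approximated in trace norm by its finite sections. -/
theorem IsState.traceNormLE_sub_sectionOp {H ι : Type*} [NormedAddCommGroup H]
    [InnerProductSpace ℂ H] [CompleteSpace H] {b : HilbertBasis ι ℂ H} {ρ : H →L[ℂ] H}
    (hρ : IsState b ρ) (S : Finset ι) :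
    TraceNormLE (ρ - sectionOp b S (opMatrix b ρ))
      (2 * √(1 - ∑ x ∈ S, (opMatrix b ρ x x).re)) := by
  classical
  intro n u v hu hv
  obtain ⟨W, hW⟩ := exists_sqrt_of_isPositive hρ.1
  set P : H →L[ℂ] H := ∑ x ∈ S, InnerProductSpace.rankOne ℂ (b x) (b x) with hP
  have hPv : ∀ w, P w = combo b S fun x => ⟪b x, w⟫_ℂ := fun w => by
    simp [hP, combo, InnerProductSpace.rankOne_apply]
  have hPb : ∀ x, P (b x) = if x ∈ S then b x else 0 := fun x => by
    simp [hPv, combo, orthonormal_iff_ite.1 b.orthonormal]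
  have hWb : ∀ x, ‖W (b x)‖ ^ 2 = (opMatrix b ρ x x).re := fun x => by
    rw [opMatrix, Matrix.of_apply, hW, inner_self_eq_norm_sq_to_K]
    norm_cast
  have hsum : HasSum (fun x => ‖W (b x)‖ ^ 2) 1 := by simpa only [hWb] using hρ.hasSum_re
  have hsumP : HasSum (fun x => ‖(W ∘L P) (b x)‖ ^ 2) (∑ x ∈ S, ‖W (b x)‖ ^ 2) := by
    have h := hasSum_sum_of_ne_finset_zero (f := fun x => ‖(W ∘L P) (b x)‖ ^ 2) (s := S)
      (L := SummationFilter.unconditional ι)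
      fun x hx => by simp [hPb, hx]
    convert h using 1
    exact Finset.sum_congr rfl fun x hx => by simp [hPb, hx]
  -- `P` projects onto the span of the section, so the squared Hilbert–Schmidt norm of `W (1 - P)`
  -- is the missing trace. Each of the two terms of `ρ - P ρ P` contains this factor once, which
  -- gives the bound `2 √δ`.
  have hsumQ : HasSum (fun x => ‖(W ∘L (1 - P)) (b x)‖ ^ 2) (1 - ∑ x ∈ S, ‖W (b x)‖ ^ 2) := by
    have hf : (fun x => ‖(W ∘L (1 - P)) (b x)‖ ^ 2) =
        fun x => ‖W (b x)‖ ^ 2 - ‖(W ∘L P) (b x)‖ ^ 2 := by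
      funext x
      by_cases hx : x ∈ S <;> simp [hPb, hx]
    rw [hf]
    exact hsum.sub hsumP
  have hle : ∑ x ∈ S, ‖W (b x)‖ ^ 2 ≤ 1 := sum_le_hasSum _ (fun _ _ => by positivity) hsum
  simp only [← hWb]
  set δ := 1 - ∑ x ∈ S, ‖W (b x)‖ ^ 2
  have hterm : ∀ k, ‖⟪u k, (ρ - sectionOp b S (opMatrix b ρ)) (v k)⟫_ℂ‖ ≤
      ‖(W ∘L (1 - P)) (u k)‖ * ‖W (v k)‖ + ‖(W ∘L (1 - P)) (v k)‖ * ‖(W ∘L P) (u k)‖ := by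
    intro k
    have h1 : ⟪u k, (ρ - sectionOp b S (opMatrix b ρ)) (v k)⟫_ℂ =
        ⟪(W ∘L (1 - P)) (u k), W (v k)⟫_ℂ + ⟪(W ∘L P) (u k), (W ∘L (1 - P)) (v k)⟫_ℂ := by
      rw [sub_apply, inner_sub_right, inner_sectionOp, ← inner_combo_apply_combo, ← hPv, ← hPv,
        hW, hW]
      simp
    rw [h1]
    refine (norm_add_le _ _).trans (add_le_add (norm_inner_le_norm _ _) ?_)
    exact (norm_inner_le_norm _ _).trans (mul_comm _ _).le
  refine (Finset.sum_le_sum fun k _ => hterm k).trans ?_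
  rw [Finset.sum_add_distrib]
  have h1 := sum_mul_le_sqrt_mul_sqrt_of_le (sum_norm_sq_apply_le b _ hsumQ hu)
    (sum_norm_sq_apply_le b _ hsum hv)
  have h2 := sum_mul_le_sqrt_mul_sqrt_of_le (sum_norm_sq_apply_le b _ hsumQ hv)
    ((sum_norm_sq_apply_le b _ hsumP hu).trans hle)
  rw [Real.sqrt_one, mul_one] at h1 h2
  linarith

/-! ### The cone of separable finite sections -/

/-- The section of a matrix, extended by zero. -/
def cutoff {ι : Type*} (S : Finset ι) (M : Matrix ι ι ℂ) : ι → ι → ℂ :=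
  open Classical in fun x y => if x ∈ S ∧ y ∈ S then M x y else 0

/-- The rank-one matrix of the product vector `α ⊗ β`, cut down to `F × G`. -/
def productSection {I J : Type*} (F : Finset I) (G : Finset J) (α : I → ℂ) (β : J → ℂ) :
    I × J → I × J → ℂ :=
  cutoff (F ×ˢ G) (Matrix.of fun x y => tprod α β x * star (tprod α β y))

/-- The convex cone generated by the product sections. -/
def separableCone {I J : Type*} (F : Finset I) (G : Finset J) :
    PointedCone ℝ (I × J → I × J → ℂ) :=
  PointedCone.hull ℝ {X | ∃ α β, X = productSection F G α β}

/-- The trace of a finite section. -/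
def sectionTrace {ι : Type*} (S : Finset ι) (X : ι → ι → ℂ) : ℝ := ∑ x ∈ S, (X x x).re

theorem rankOne_combo {H ι : Type*} [NormedAddCommGroup H] [InnerProductSpace ℂ H]
    (b : ι → H) (S : Finset ι) (φ : ι → ℂ) :
    InnerProductSpace.rankOne ℂ (combo b S φ) (combo b S φ) =
      sectionOp b S (Matrix.of fun x y => φ x * star (φ y)) := by
  ext v
  simp only [InnerProductSpace.rankOne_apply, sectionOp, sum_apply, smul_apply, Matrix.of_apply]
  rw [combo, Finset.smul_sum]
  refine Finset.sum_congr rfl fun x _ => ?_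
  rw [sum_inner, Finset.sum_smul]
  refine Finset.sum_congr rfl fun y _ => ?_
  rw [inner_smul_left, smul_smul, smul_smul, starRingEnd_apply]
  congr 1
  ring

/-- Normalize both vectors; if one vanishes, the factor is zero and any mixture serves, which is
what `hne` supplies. -/
theorem rankOne_ket_eq_smul {HA HB : Type*} [NormedAddCommGroup HA] [InnerProductSpace ℂ HA]
    [NormedAddCommGroup HB] [InnerProductSpace ℂ HB]
    (hne : (convexHull ℝ (pureProductStates HA HB)).Nonempty) (a : HA) (b : HB) :
    ∃ σ ∈ convexHull ℝ (pureProductStates HA HB),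
      InnerProductSpace.rankOne ℂ (ket a b) (ket a b) = ((‖a‖ ^ 2 * ‖b‖ ^ 2 : ℝ) : ℂ) • σ := by
  obtain ⟨σ₀, hσ₀⟩ := hne
  rcases eq_or_ne a 0 with rfl | ha
  · exact ⟨σ₀, hσ₀, by rw [← ketₗ_apply]; simp⟩
  rcases eq_or_ne b 0 with rfl | hb
  · exact ⟨σ₀, hσ₀, by rw [← ketₗ_apply]; simp⟩
  have hna : ‖a‖ ≠ 0 := norm_ne_zero_iff.2 ha
  have hnb : ‖b‖ ≠ 0 := norm_ne_zero_iff.2 hb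
  set r : ℂ := ((‖a‖⁻¹ : ℝ) : ℂ) with hr
  set s : ℂ := ((‖b‖⁻¹ : ℝ) : ℂ) with hs
  refine ⟨_, subset_convexHull ℝ _ ⟨r • a, s • b,
      by rw [norm_smul, hr, Complex.norm_real, norm_inv, norm_norm, inv_mul_cancel₀ hna],
      by rw [norm_smul, hs, Complex.norm_real, norm_inv, norm_norm, inv_mul_cancel₀ hnb], rfl⟩, ?_⟩
  have hk : ket (r • a) (s • b) = (((‖a‖⁻¹ * ‖b‖⁻¹ : ℝ)) : ℂ) • (ket a b : HTensor HA HB) := by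
    rw [← ketₗ_apply, map_smul, map_smul, LinearMap.smul_apply, smul_smul, ketₗ_apply,
      hr, hs, Complex.ofReal_mul, mul_comm]
  rw [hk]
  ext v
  simp only [InnerProductSpace.rankOne_apply, smul_apply, inner_smul_left, smul_smul,
    Complex.conj_ofReal]
  congr 1
  have hna' : (‖a‖ : ℂ) ≠ 0 := by exact_mod_cast hna
  have hnb' : (‖b‖ : ℂ) ≠ 0 := by exact_mod_cast hnb
  push_cast
  field_simp

theorem sectionOp_add {H ι : Type*} [NormedAddCommGroup H] [InnerProductSpace ℂ H]
    (b : ι → H) (S : Finset ι) (M N : Matrix ι ι ℂ) :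
    sectionOp b S (M + N) = sectionOp b S M + sectionOp b S N := by
  simp only [sectionOp, Matrix.add_apply, add_smul, Finset.sum_add_distrib]

theorem sectionOp_smul {H ι : Type*} [NormedAddCommGroup H] [InnerProductSpace ℂ H]
    (b : ι → H) (S : Finset ι) (c : ℂ) (M : Matrix ι ι ℂ) :
    sectionOp b S (c • M) = c • sectionOp b S M := by
  simp only [sectionOp, Matrix.smul_apply, smul_eq_mul, mul_smul, Finset.smul_sum]

theorem sectionOp_congr {H ι : Type*} [NormedAddCommGroup H] [InnerProductSpace ℂ H]
    (b : ι → H) (S : Finset ι) {M N : Matrix ι ι ℂ} (h : ∀ x ∈ S, ∀ y ∈ S, M x y = N x y) :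
    sectionOp b S M = sectionOp b S N :=
  Finset.sum_congr rfl fun x hx => Finset.sum_congr rfl fun y hy => by rw [h x hx y hy]

/-- Elements of the separable cone are multiples of mixtures of product states. -/
theorem sectionOp_eq_smul_of_mem_separableCone {HA HB I J : Type*} [NormedAddCommGroup HA]
    [InnerProductSpace ℂ HA] [NormedAddCommGroup HB] [InnerProductSpace ℂ HB]
    (e : HilbertBasis I ℂ HA) (f : HilbertBasis J ℂ HB)
    (hne : (convexHull ℝ (pureProductStates HA HB)).Nonempty) (F : Finset I) (G : Finset J)
    {X : I × J → I × J → ℂ} (hX : X ∈ separableCone F G) :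
    0 ≤ sectionTrace (F ×ˢ G) X ∧ ∃ σ ∈ convexHull ℝ (pureProductStates HA HB),
      sectionOp (prodBasis e f) (F ×ˢ G) (Matrix.of X) =
        (sectionTrace (F ×ˢ G) X : ℂ) • σ := by
  classical
  induction hX using Submodule.span_induction with
  | mem X hX =>
    obtain ⟨α, β, rfl⟩ := hX
    have htr : sectionTrace (F ×ˢ G) (productSection F G α β) =
        ‖combo e F α‖ ^ 2 * ‖combo f G β‖ ^ 2 := by
      rw [norm_combo_sq e.orthonormal, norm_combo_sq f.orthonormal, Finset.sum_mul_sum,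
        ← Finset.sum_product']
      refine Finset.sum_congr rfl fun x hx => ?_
      rw [productSection, cutoff, if_pos ⟨hx, hx⟩, Matrix.of_apply, Complex.star_def, Complex.mul_conj, Complex.ofReal_re,
        Complex.normSq_eq_norm_sq, tprod, norm_mul, mul_pow]
    refine ⟨by rw [htr]; positivity, ?_⟩
    obtain ⟨σ, hσ, h⟩ := rankOne_ket_eq_smul hne (combo e F α) (combo f G β)
    refine ⟨σ, hσ, ?_⟩
    rw [htr, ← h, ket_combo, rankOne_combo]
    exact sectionOp_congr _ _ fun x hx y hy => if_pos ⟨hx, hy⟩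
  | zero =>
    obtain ⟨σ₀, hσ₀⟩ := hne
    have h0 : sectionTrace (F ×ˢ G) (0 : I × J → I × J → ℂ) = 0 := by simp [sectionTrace]
    exact ⟨h0.ge, σ₀, hσ₀, by rw [h0]; simp [sectionOp]⟩
  | add X Y _ _ hX hY =>
    obtain ⟨hX0, σ, hσ, hXσ⟩ := hX
    obtain ⟨hY0, τ, hτ, hYτ⟩ := hY
    have hadd : sectionTrace (F ×ˢ G) (X + Y) =
        sectionTrace (F ×ˢ G) X + sectionTrace (F ×ˢ G) Y := by
      simp [sectionTrace, Finset.sum_add_distrib]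
    have hop : sectionOp (prodBasis e f) (F ×ˢ G) (Matrix.of (X + Y)) =
        (sectionTrace (F ×ˢ G) X : ℂ) • σ + (sectionTrace (F ×ˢ G) Y : ℂ) • τ := by
      rw [← hXσ, ← hYτ, ← sectionOp_add]
      rfl
    rw [hadd, hop]
    generalize sectionTrace (F ×ˢ G) X = p at *
    generalize sectionTrace (F ×ˢ G) Y = q at *
    refine ⟨add_nonneg hX0 hY0, ?_⟩
    -- The mixture has weights `p / (p + q)` and `q / (p + q)`, so vanishing total trace is
    -- separate.
    rcases (add_nonneg hX0 hY0).eq_or_lt with h0 | h0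
    · have hp : p = 0 := by linarith
      have hq : q = 0 := by linarith
      exact ⟨σ, hσ, by simp [hp, hq]⟩
    · refine ⟨_, smul_add_smul_mem_convexHull_pure hσ hτ (div_nonneg hX0 h0.le)
        (div_nonneg hY0 h0.le) (by rw [← add_div, div_self h0.ne']), ?_⟩
      rw [smul_add, smul_smul, smul_smul, ← Complex.ofReal_mul, ← Complex.ofReal_mul,
        mul_div_cancel₀ _ h0.ne', mul_div_cancel₀ _ h0.ne']
  | smul c X _ hX =>
    obtain ⟨hX0, σ, hσ, hXσ⟩ := hX
    obtain ⟨c, hc⟩ := c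
    have hcX : (⟨c, hc⟩ : {c : ℝ // 0 ≤ c}) • X = (c : ℂ) • X := by
      funext x y
      exact Complex.real_smul
    have hs : sectionTrace (F ×ˢ G) ((c : ℂ) • X) = c * sectionTrace (F ×ˢ G) X := by
      simp only [sectionTrace, Pi.smul_apply, smul_eq_mul, Complex.re_ofReal_mul, Finset.mul_sum]
    have hop : sectionOp (prodBasis e f) (F ×ˢ G) (Matrix.of ((c : ℂ) • X)) =
        (c : ℂ) • (sectionTrace (F ×ˢ G) X : ℂ) • σ := by
      rw [← hXσ, ← sectionOp_smul]
      rfl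
    rw [hcX, hs]
    exact ⟨mul_nonneg hc hX0, σ, hσ, by rw [hop, smul_smul, Complex.ofReal_mul]⟩

theorem IsState.exists_norm_eq_one {HA HB I J : Type*} [NormedAddCommGroup HA]
    [InnerProductSpace ℂ HA] [NormedAddCommGroup HB] [InnerProductSpace ℂ HB]
    {e : HilbertBasis I ℂ HA} {f : HilbertBasis J ℂ HB}
    {ρ : HTensor HA HB →L[ℂ] HTensor HA HB} (hρ : IsState (prodBasis e f) ρ) :
    ∃ (a : HA) (b : HB), ‖a‖ = 1 ∧ ‖b‖ = 1 := by
  rcases isEmpty_or_nonempty (I × J) with h | ⟨⟨i, j⟩⟩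
  · exact absurd (hρ.hasSum_re.unique hasSum_empty) one_ne_zero
  · exact ⟨e i, f j, e.orthonormal.1 i, f.orthonormal.1 j⟩

theorem IsState.exists_rectangle {H I J : Type*} [NormedAddCommGroup H] [InnerProductSpace ℂ H]
    {b : HilbertBasis (I × J) ℂ H} {ρ : H →L[ℂ] H} (hρ : IsState b ρ) {η : ℝ} (hη : 0 < η) :
    ∃ (F : Finset I) (G : Finset J), |1 - ∑ x ∈ F ×ˢ G, (opMatrix b ρ x x).re| < η := by
  classical
  have h : Filter.Tendsto (fun S : Finset (I × J) => ∑ x ∈ S, (opMatrix b ρ x x).re)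
      Filter.atTop (𝓝 1) := by
    simpa only [HasSum, SummationFilter.unconditional_filter] using hρ.hasSum_re
  obtain ⟨S, hS⟩ := ((h.comp tendsto_rectangle).eventually (Metric.ball_mem_nhds _ hη)).exists
  exact ⟨S.1, S.2, by rw [abs_sub_comm]; simpa [Real.dist_eq] using hS⟩

/-- A state all of whose sections are limits of separable sections is separable. -/
theorem isSeparable_of_forall_mem_closure {HA HB I J : Type*} [NormedAddCommGroup HA]
    [InnerProductSpace ℂ HA] [NormedAddCommGroup HB] [InnerProductSpace ℂ HB]
    {e : HilbertBasis I ℂ HA} {f : HilbertBasis J ℂ HB}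
    {ρ : HTensor HA HB →L[ℂ] HTensor HA HB} (hρ : IsState (prodBasis e f) ρ)
    (h : ∀ (F : Finset I) (G : Finset J), cutoff (F ×ˢ G) (opMatrix (prodBasis e f) ρ) ∈
      closure (separableCone F G : Set (I × J → I × J → ℂ))) : IsSeparable ρ := by
  classical
  intro ε hε
  have hne : (convexHull ℝ (pureProductStates HA HB)).Nonempty := by
    obtain ⟨a, b, ha, hb⟩ := hρ.exists_norm_eq_one
    exact ⟨_, subset_convexHull ℝ _ ⟨a, b, ha, hb, rfl⟩⟩
  -- The errors are `2 * δ` for truncating `ρ`, `δ` for replacing the section by `X`, and `2 * δ`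
  -- for normalizing `X`, whose trace is within `δ + δ ^ 2` of one. The minimum with `1` ensures `δ
  -- ^ 2 ≤ δ`.
  set δ := min ε 1 / 6 with hδ
  have hδ0 : 0 < δ := by positivity
  have hδε : 6 * δ ≤ ε := by rw [hδ]; linarith [min_le_left ε 1]
  have hδ1 : 6 * δ ≤ 1 := by rw [hδ]; linarith [min_le_right ε 1]
  obtain ⟨F, G, hFG⟩ := hρ.exists_rectangle (η := δ ^ 2) (by positivity)
  set S := F ×ˢ G with hS
  set M := opMatrix (prodBasis e f) ρ with hM
  have hopen : IsOpen {X : I × J → I × J → ℂ | ∑ x ∈ S, ∑ y ∈ S, ‖M x y - X x y‖ < δ} := by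
    refine isOpen_lt ?_ continuous_const
    have hc : ∀ x y : I × J, Continuous fun X : I × J → I × J → ℂ => X x y :=
      fun x y => (continuous_apply y).comp (continuous_apply x)
    fun_prop
  obtain ⟨X, hXδ, hXK⟩ := mem_closure_iff.1 (h F G) _ hopen (by
    change ∑ x ∈ S, ∑ y ∈ S, ‖M x y - cutoff S M x y‖ < δ
    have : ∑ x ∈ S, ∑ y ∈ S, ‖M x y - cutoff S M x y‖ = 0 :=
      Finset.sum_eq_zero fun x hx => Finset.sum_eq_zero fun y hy => by simp [cutoff, hx, hy]
    rwa [this])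
  obtain ⟨hX0, σ, hσ, hXσ⟩ := sectionOp_eq_smul_of_mem_separableCone e f hne F G hXK
  refine ⟨σ, hσ, ?_⟩
  have htr : |∑ x ∈ S, (M x x).re - sectionTrace S X| ≤ δ := by
    refine le_trans ?_ (le_of_lt hXδ)
    rw [sectionTrace, ← Finset.sum_sub_distrib]
    refine (Finset.abs_sum_le_sum_abs _ _).trans (Finset.sum_le_sum fun x hx => ?_)
    refine le_trans ?_ (Finset.single_le_sum (f := fun y => ‖M x y - X x y‖)
      (fun _ _ => norm_nonneg _) hx)
    rw [← Complex.sub_re]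
    exact Complex.abs_re_le_norm _
  have hdecomp : ρ - σ = (ρ - sectionOp (prodBasis e f) S M) +
      sectionOp (prodBasis e f) S (M - Matrix.of X) +
      ((sectionTrace S X - 1 : ℝ) : ℂ) • σ := by
    have hsub : sectionOp (prodBasis e f) S M =
        sectionOp (prodBasis e f) S (M - Matrix.of X) +
          sectionOp (prodBasis e f) S (Matrix.of X) := by
      rw [← sectionOp_add, sub_add_cancel]
    rw [hsub, hXσ, Complex.ofReal_sub, sub_smul, Complex.ofReal_one, one_smul]
    abel
  rw [hdecomp]
  refine (((hρ.traceNormLE_sub_sectionOp S).add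
    (traceNormLE_sectionOp (prodBasis e f).orthonormal S _)).add
    ((traceNormLE_of_mem_convexHull_pure hσ).smul _)).mono ?_
  have h1 : √(1 - ∑ x ∈ S, (M x x).re) ≤ δ :=
    Real.sqrt_le_iff.2 ⟨hδ0.le, ((le_abs_self _).trans hFG.le)⟩
  have h2 : ∑ x ∈ S, ∑ y ∈ S, ‖(M - Matrix.of X) x y‖ ≤ δ := le_of_lt hXδ
  have h3 : ‖((sectionTrace S X - 1 : ℝ) : ℂ)‖ ≤ 2 * δ := by
    rw [Complex.norm_real, Real.norm_eq_abs]
    have hsq : δ ^ 2 ≤ δ := by nlinarith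
    have := abs_le.1 htr
    have := abs_lt.1 hFG
    exact abs_le.2 ⟨by linarith, by linarith⟩
  linarith

/-! ### Witnesses for entangled states -/

/-- Real functionals on matrices are represented by Hermitian matrices. -/
theorem exists_hermitian_representation {ι : Type*} (L : (ι → ι → ℂ) →ₗ[ℝ] ℝ) :
    ∃ K : Matrix ι ι ℂ, (∀ x y, star (K x y) = K y x) ∧
      ∀ (S : Finset ι) (M : Matrix ι ι ℂ), (∀ x y, star (M x y) = M y x) →
        ∑ x ∈ S, ∑ y ∈ S, M x y * K y x = (L (cutoff S M) : ℂ) := by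
  classical
  let E : ι → ι → ℂ → ι → ι → ℂ := fun x y z x' y' => if x' = x ∧ y' = y then z else 0
  -- Chosen so that `L (E x y z)` is the real part of `z * w x y`.
  let w : ι → ι → ℂ := fun x y => ⟨L (E x y 1), -L (E x y Complex.I)⟩
  have hw : ∀ (S : Finset ι) (M : Matrix ι ι ℂ),
      (∑ x ∈ S, ∑ y ∈ S, M x y * w x y).re = L (cutoff S M) := by
    intro S M
    have hM : cutoff S M =
        ∑ x ∈ S, ∑ y ∈ S, ((M x y).re • E x y 1 + (M x y).im • E x y Complex.I) := by
      funext x' y'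
      simp only [Finset.sum_apply, Pi.add_apply, Pi.smul_apply, E, Complex.real_smul]
      have h1 : ∀ x y, (((M x y).re : ℂ) * (if x' = x ∧ y' = y then 1 else 0) +
          ((M x y).im : ℂ) * (if x' = x ∧ y' = y then Complex.I else 0)) =
          if x' = x then if y' = y then M x y else 0 else 0 := by
        intro x y
        by_cases hx : x' = x <;> by_cases hy : y' = y <;> simp [hx, hy, Complex.re_add_im]
      simp only [h1, cutoff]
      by_cases hx : x' ∈ S <;> by_cases hy : y' ∈ S <;>
        simp [hx, hy, Finset.sum_ite_irrel]
    rw [hM]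
    simp only [map_sum, map_add, map_smul, Complex.re_sum, Complex.mul_re, smul_eq_mul, w]
    exact Finset.sum_congr rfl fun x _ => Finset.sum_congr rfl fun y _ => by ring
  -- The Hermitian part of the transpose of `w`: against a Hermitian `M` it yields exactly the real
  -- part.
  refine ⟨Matrix.of fun x y => (w y x + star (w x y)) / 2, fun x y => ?_, fun S M hM => ?_⟩
  · simp only [Matrix.of_apply, Complex.star_def, map_div₀, map_add, Complex.conj_conj,
      map_ofNat, add_comm]
  · rw [← hw S M, Complex.re_eq_add_conj, map_sum]
    have hconj : ∑ x ∈ S, (starRingEnd ℂ) (∑ y ∈ S, M x y * w x y) =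
        ∑ x ∈ S, ∑ y ∈ S, M x y * star (w y x) := by
      rw [Finset.sum_comm]
      refine Finset.sum_congr rfl fun x _ => ?_
      rw [map_sum]
      refine Finset.sum_congr rfl fun y _ => ?_
      rw [← hM y x, map_mul, ← starRingEnd_apply (M y x), Complex.conj_conj]
      rfl
    rw [hconj, ← Finset.sum_add_distrib, Finset.sum_div]
    refine Finset.sum_congr rfl fun x _ => ?_
    rw [← Finset.sum_add_distrib, Finset.sum_div]
    refine Finset.sum_congr rfl fun y _ => ?_
    rw [Matrix.of_apply]
    ring

theorem star_sectionForm {ι : Type*} {M : Matrix ι ι ℂ} (hM : ∀ x y, star (M x y) = M y x)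
    (S : Finset ι) (φ ψ : ι → ℂ) : star (sectionForm M S φ ψ) = sectionForm M S ψ φ := by
  simp only [sectionForm, star_sum]
  rw [Finset.sum_comm]
  refine Finset.sum_congr rfl fun x _ => Finset.sum_congr rfl fun y _ => ?_
  rw [star_mul', star_mul', star_star, hM]
  ring

theorem isSymmetric_sectionOp {H ι : Type*} [NormedAddCommGroup H] [InnerProductSpace ℂ H]
    (b : ι → H) (S : Finset ι) {M : Matrix ι ι ℂ} (hM : ∀ x y, star (M x y) = M y x) (u v : H) :
    ⟪sectionOp b S M u, v⟫_ℂ = ⟪u, sectionOp b S M v⟫_ℂ := by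
  rw [← inner_conj_symm, inner_sectionOp, inner_sectionOp, starRingEnd_apply, star_sectionForm hM]

/-- The quadratic form of `D` is at least `-‖D‖ ‖v‖²`. The shift is harmless for a witness: it adds
`‖D‖` both to the trace against a state and to every product expectation. -/
theorem isPositive_norm_smul_one_add {H : Type*} [NormedAddCommGroup H] [InnerProductSpace ℂ H]
    {D : H →L[ℂ] H} (hD : ∀ u v, ⟪D u, v⟫_ℂ = ⟪u, D v⟫_ℂ) :
    ((‖D‖ : ℂ) • (1 : H →L[ℂ] H) + D).IsPositive := by
  refine ⟨fun u v => ?_, fun v => ?_⟩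
  · simp [inner_add_left, inner_add_right, hD]
  · have h1 : |(⟪D v, v⟫_ℂ).re| ≤ ‖D‖ * ‖v‖ * ‖v‖ :=
      (Complex.abs_re_le_norm _).trans ((norm_inner_le_norm _ _).trans
        (mul_le_mul_of_nonneg_right (D.le_opNorm v) (norm_nonneg _)))
    have h2 : ((‖D‖ : ℂ) • (1 : H →L[ℂ] H) + D).reApplyInnerSelf v =
        ‖D‖ * ‖v‖ ^ 2 + (⟪D v, v⟫_ℂ).re := by
      rw [ContinuousLinearMap.reApplyInnerSelf_apply, add_apply, smul_apply, inner_add_left,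
        inner_smul_left, Complex.conj_ofReal, one_apply_eq_self,
        inner_self_eq_norm_sq_to_K]
      simp [← Complex.ofReal_pow]
    rw [h2]
    linarith [(abs_le.1 h1).1]

theorem inner_prodBasis_ket {HA HB I J : Type*} [NormedAddCommGroup HA] [InnerProductSpace ℂ HA]
    [NormedAddCommGroup HB] [InnerProductSpace ℂ HB]
    (e : HilbertBasis I ℂ HA) (f : HilbertBasis J ℂ HB) (a : HA) (b : HB) (x : I × J) :
    ⟪prodBasis e f x, ket a b⟫_ℂ = tprod (fun i => ⟪e i, a⟫_ℂ) (fun j => ⟪f j, b⟫_ℂ) x := by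
  rw [prodBasis_apply, inner_ket]
  rfl

theorem opMatrix_sectionOp {H ι : Type*} [NormedAddCommGroup H] [InnerProductSpace ℂ H]
    (b : HilbertBasis ι ℂ H) (S : Finset ι) (M : Matrix ι ι ℂ) (x y : ι) :
    opMatrix b (sectionOp b S M) x y = cutoff S M x y := by
  classical
  rw [opMatrix, Matrix.of_apply, inner_sectionOp]
  simp only [sectionForm, orthonormal_iff_ite.1 b.orthonormal, cutoff]
  by_cases hx : x ∈ S <;> by_cases hy : y ∈ S <;> simp [hx, hy]

/-- The identity and the rectangle are both invariant under partial transposition, so transposing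
the witness just restores `K`. -/
theorem partialTranspose_witness {H I J : Type*} [NormedAddCommGroup H] [InnerProductSpace ℂ H]
    (b : HilbertBasis (I × J) ℂ H) (F : Finset I) (G : Finset J) (K : Matrix (I × J) (I × J) ℂ)
    (c : ℂ) [DecidableEq (I × J)] (x y : I × J) :
    partialTranspose (opMatrix b
      (c • (1 : H →L[ℂ] H) + sectionOp b (F ×ˢ G) (partialTranspose K))) x y =
      (if x = y then c else 0) + cutoff (F ×ˢ G) K x y := by
  have h : opMatrix b (c • (1 : H →L[ℂ] H) + sectionOp b (F ×ˢ G) (partialTranspose K))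
      (x.1, y.2) (y.1, x.2) = (if (x.1, y.2) = (y.1, x.2) then c else 0) +
        cutoff (F ×ˢ G) (partialTranspose K) (x.1, y.2) (y.1, x.2) := by
    rw [← opMatrix_sectionOp b]
    simp [opMatrix, orthonormal_iff_ite.1 b.orthonormal]
  refine h.trans ?_
  have h1 : (x.1, y.2) = (y.1, x.2) ↔ x = y := by
    rw [Prod.ext_iff, Prod.ext_iff]
    exact and_congr_right fun _ => eq_comm
  congr 1
  · simp only [h1]
  · have h2 : ((x.1, y.2) ∈ F ×ˢ G ∧ (y.1, x.2) ∈ F ×ˢ G) ↔ (x ∈ F ×ˢ G ∧ y ∈ F ×ˢ G) := by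
      simp only [Finset.mem_product]
      tauto
    by_cases hxy : x ∈ F ×ˢ G ∧ y ∈ F ×ˢ G
    · rw [cutoff, cutoff, if_pos (h2.2 hxy), if_pos hxy]
      rfl
    · rw [cutoff, cutoff, if_neg (mt h2.1 hxy), if_neg hxy]

/-- A hyperplane separating a section from the separable cone yields a witness. -/
theorem exists_witness_of_notMem_closure {HA HB I J : Type*} [NormedAddCommGroup HA]
    [InnerProductSpace ℂ HA] [NormedAddCommGroup HB] [InnerProductSpace ℂ HB]
    {e : HilbertBasis I ℂ HA} {f : HilbertBasis J ℂ HB}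
    {ρ : HTensor HA HB →L[ℂ] HTensor HA HB} (hρ : IsState (prodBasis e f) ρ)
    {F : Finset I} {G : Finset J} (h : cutoff (F ×ˢ G) (opMatrix (prodBasis e f) ρ) ∉
      closure (separableCone F G : Set (I × J → I × J → ℂ))) :
    ∃ C : HTensor HA HB →L[ℂ] HTensor HA HB, C.IsPositive ∧
      ∃ t : ℝ, HasTracePT e f ρ C t ∧ t < infProduct C := by
  classical
  -- Separation from a closed cone gives `L ≥ 0` on the cone and `L < 0` at the section of `ρ`.
  let P : ProperCone ℝ (I × J → I × J → ℂ) :=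
    { (separableCone F G).closure with isClosed' := isClosed_closure }
  obtain ⟨L, hLP, hLρ⟩ := ProperCone.hyperplane_separation_point P h
  obtain ⟨K, hK, hKL⟩ := exists_hermitian_representation L.toLinearMap
  set B := prodBasis e f with hB
  set S := F ×ˢ G with hS
  set D : HTensor HA HB →L[ℂ] HTensor HA HB := sectionOp B S (partialTranspose K) with hD
  have hPK : ∀ x y, star (partialTranspose K x y) = partialTranspose K y x := fun x y => hK _ _
  have hpos := isPositive_norm_smul_one_add (isSymmetric_sectionOp B S hPK)
  have hherm : ∀ x y, star (opMatrix B ρ x y) = opMatrix B ρ y x :=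
    fun x y => (inner_conj_symm _ _).trans (hρ.1.1 _ _)
  refine ⟨(‖D‖ : ℂ) • 1 + D, hpos, ‖D‖ + L (cutoff S (opMatrix B ρ)), ?_, ?_⟩
  · have htr : Filter.Tendsto (fun T : Finset (I × J) => ∑ x ∈ T, opMatrix B ρ x x)
        Filter.atTop (𝓝 1) := by
      simpa only [HasSum, SummationFilter.unconditional_filter] using hρ.2
    have hlim := ((htr.comp tendsto_rectangle).mul_const (‖D‖ : ℂ)).add_const
      (L (cutoff S (opMatrix B ρ)) : ℂ)
    rw [one_mul, ← Complex.ofReal_add] at hlim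
    refine hlim.congr' ?_
    -- Beyond `S` the contribution of `K` is constant; only the identity part varies, and it tends
    -- to `‖D‖` times the trace of `ρ`.
    filter_upwards [tendsto_rectangle.eventually (Filter.eventually_ge_atTop S)] with T hT
    have hcut : ∑ x ∈ T.1 ×ˢ T.2, ∑ y ∈ T.1 ×ˢ T.2, opMatrix B ρ x y * cutoff S K y x =
        (L (cutoff S (opMatrix B ρ)) : ℂ) := by
      refine Eq.trans ?_ (hKL S (opMatrix B ρ) hherm)
      symm
      refine Finset.sum_subset_zero_on_sdiff hT (fun x hx => ?_) (fun x hx => ?_)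
      · refine Finset.sum_eq_zero fun y _ => ?_
        simp [cutoff, (Finset.mem_sdiff.1 hx).2]
      · refine Finset.sum_subset_zero_on_sdiff hT (fun y hy => ?_) (fun y hy => ?_)
        · simp [cutoff, (Finset.mem_sdiff.1 hy).2]
        · simp [cutoff, hx, hy]
    have hwit := partialTranspose_witness B F G K (‖D‖ : ℂ)
    change _ = ∑ x ∈ T.1 ×ˢ T.2, ∑ y ∈ T.1 ×ˢ T.2,
      opMatrix B ρ x y * partialTranspose (opMatrix B ((‖D‖ : ℂ) • 1 + D)) y x
    simp only [Function.comp_apply, hD, hS] at hwit ⊢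
    simp only [hwit, mul_add, Finset.sum_add_distrib]
    rw [← hS, hcut, Finset.sum_mul]
    congr 1
    refine Finset.sum_congr rfl fun x hx => ?_
    simp only [mul_ite, mul_zero]
    rw [Finset.sum_ite_eq' _ _ _, if_pos hx]
  · refine lt_of_lt_of_le (show _ < ‖D‖ by linarith) (le_csInf ?_ ?_)
    · obtain ⟨a, b, ha, hb⟩ := hρ.exists_norm_eq_one
      exact ⟨_, a, b, ha, hb, rfl⟩
    · rintro r ⟨a, b, ha, hb, rfl⟩
      have hnorm : ⟪ket a b, (ket a b : HTensor HA HB)⟫_ℂ = 1 := by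
        rw [inner_self_eq_norm_sq_to_K, norm_ket, ha, hb]
        simp
      rw [add_apply, smul_apply, inner_add_right, inner_smul_right, one_apply_eq_self,
        hnorm, mul_one, Complex.add_re, Complex.ofReal_re, hD, inner_sectionOp]
      simp only [hB, inner_prodBasis_ket]
      rw [sectionForm_partialTranspose, partialTranspose_partialTranspose, ← sum_rankOne_mul]
      set α := fun i => ⟪e i, a⟫_ℂ
      -- The conjugated product vector is again a product vector, so its section lies in the cone
      -- and `L` is nonnegative on it.
      set β := star fun j => ⟪f j, b⟫_ℂ
      have hprod := hKL S (Matrix.of fun x y => tprod α β x * star (tprod α β y))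
        fun x y => by
          simp only [Matrix.of_apply]
          rw [star_mul', star_star, mul_comm]
      simp only [Matrix.of_apply] at hprod
      rw [hprod, Complex.ofReal_re]
      have hmem : cutoff S (Matrix.of fun x y => tprod α β x * star (tprod α β y)) ∈
          separableCone F G := Submodule.subset_span ⟨α, β, rfl⟩
      have := hLP _ (subset_closure hmem)
      exact le_add_of_nonneg_right this

theorem IsEntangled.exists_witness {HA HB I J : Type*} [NormedAddCommGroup HA]
    [InnerProductSpace ℂ HA] [NormedAddCommGroup HB] [InnerProductSpace ℂ HB]
    {e : HilbertBasis I ℂ HA} {f : HilbertBasis J ℂ HB}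
    {ρ : HTensor HA HB →L[ℂ] HTensor HA HB} (hρ : IsState (prodBasis e f) ρ)
    (hent : IsEntangled ρ) : ∃ C : HTensor HA HB →L[ℂ] HTensor HA HB, C.IsPositive ∧
      ∃ t : ℝ, HasTracePT e f ρ C t ∧ t < infProduct C := by
  by_contra hC
  refine hent (isSeparable_of_forall_mem_closure hρ fun F G => ?_)
  by_contra hFG
  exact hC (exists_witness_of_notMem_closure hρ hFG)

end

end Bipartite

/-! ### The equivalence -/

theorem mainTheorem8 {HA HB I J : Type*}
    [NormedAddCommGroup HA] [InnerProductSpace ℂ HA] [CompleteSpace HA]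
    [NormedAddCommGroup HB] [InnerProductSpace ℂ HB] [CompleteSpace HB]
    (e : HilbertBasis I ℂ HA) (f : HilbertBasis J ℂ HB)
    (ρ : Bipartite.HTensor HA HB →L[ℂ] Bipartite.HTensor HA HB)
    (hρ : Bipartite.IsState (Bipartite.prodBasis e f) ρ) :
    (Bipartite.IsPPT e f ρ ∧ Bipartite.IsBoundEntangled e f ρ) ↔
      ((∀ C : Bipartite.HTensor HA HB →L[ℂ] Bipartite.HTensor HA HB, C.IsPositive →
          ∃ t : ℝ, Bipartite.HasTracePT e f ρ C t ∧ 0 ≤ t) ∧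
        (∃ C : Bipartite.HTensor HA HB →L[ℂ] Bipartite.HTensor HA HB, C.IsPositive ∧
          ∃ t : ℝ, Bipartite.HasTracePT e f ρ C t ∧ t < Bipartite.infProduct C)) := by
  constructor
  · rintro ⟨hP, hent, -⟩
    exact ⟨fun C hC => hP.exists_hasTracePT hρ hC, hent.exists_witness hρ⟩
  · rintro ⟨h1, C, hC, t, ht, hlt⟩
    have hP := Bipartite.isPPT_of_hasTracePT_nonneg hρ.1 h1
    exact ⟨hP, fun hs => hlt.not_ge (hs.infProduct_le hρ hC ht), hP.not_isDistillable⟩
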